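/- A \emph{Goodey graph} is a finite connected cubic plane graph (simple, embedded in the plane/sphere) all of whose faces, including the outer one, have size $4$ or $6$. A \emph{distance-two four-coloring} of a graph is an assignment of colors from $\{1,2,3,4\}$ to its vertices such that, for every vertex $v$, the colors of $v$ and of all the neighbors of $v$ are all distinct. For $k\ge 0$, let $C_k$ be the plane graph obtained from the cube by replacing each vertex with a triangular piece of the hexagonal lattice having $(k+1)^2$ vertices, the pieces of two adjacent cube vertices being joined by $k+1$ edges. Precisely: subdivide each of the eight triangular sides of the octahedron $\{|x|+|y|+|z|=k+1\}\subset\mathbb{R}^3$ into $(k+1)^2$ unit triangles whose corners are points of $\mathbb{Z}^3$; the vertices of $C_k$ are these small triangles, two being adjacent if they share an edge, with the embedding in the octahedral sphere dual to this triangulation. Thus $C_0$ is the cube, and $C_k$ has six square faces, any two non-opposite ones being joined by a straight chain of $k$ hexagons. \textbf{Theorem.} Every $C_k$, $k\ge 0$, is a Goodey graph, and a Goodey graph admits a distance-two four-coloring if and only if it is isomorphic, as a plane graph, to $C_k$ for some $k\ge 0$. -/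

import Mathlib

/-- A rotation system on a graph `G`: a permutation of the darts (oriented edges) of `G` which, at
each vertex, permutes the darts leaving that vertex in one single cycle. This is the combinatorial
form of a cellular embedding of `G` in an oriented closed surface: `rot d` is the next dart after
`d` in the (counterclockwise) order around the tail of `d`. -/
structure RotationSystem {V : Type*} (G : SimpleGraph V) where
  rot : Equiv.Perm G.Dart
  rot_fst : ∀ d, (rot d).fst = d.fst
  sameCycle_of_fst_eq : ∀ d d' : G.Dart, d.fst = d'.fst → rot.SameCycle d d'

namespace RotationSystem

variable {V : Type*} {G : SimpleGraph V}

/-- One step of a facial walk: go along the dart `d` and leave its head along the dart that follows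
the reversal of `d` in the rotation there. -/
def faceStep (R : RotationSystem G) : Equiv.Perm G.Dart :=
  (SimpleGraph.Dart.symm_involutive (G := G)).toPerm.trans R.rot

/-- The faces are the facial walks, i.e. the orbits of `faceStep`. (This is the right notion for
connected graphs with at least one edge, the only ones it is used for.) -/
def Face (R : RotationSystem G) : Type _ :=
  Quotient (Equiv.Perm.SameCycle.setoid R.faceStep)

/-- The size of the face to which the dart `d` belongs: the length of the closed facial walk
through `d`. -/
noncomputable def faceSize (R : RotationSystem G) (d : G.Dart) : ℕ :=
  Function.minimalPeriod R.faceStep d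

/-- An isomorphism of embedded graphs: a graph isomorphism that carries one rotation system to the
other. -/
def IsIsoTo {W : Type*} {H : SimpleGraph W} (R : RotationSystem G) (S : RotationSystem H) : Prop :=
  ∃ e : G ≃g H, ∀ d : G.Dart, e.toHom.mapDart (R.rot d) = S.rot (e.toHom.mapDart d)

/-- A Goodey graph: a finite connected cubic plane graph all of whose faces have size 4 or 6.
For a connected graph with a rotation system, being embedded in the sphere
(equivalently, in the plane) means Euler's formula `|V| - |E| + |F| = 2`. -/
structure IsGoodey (R : RotationSystem G) : Prop where
  finite : Finite V
  connected : G.Connected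
  cubic : ∀ v, (G.neighborSet v).ncard = 3
  euler : Nat.card V + Nat.card R.Face = Nat.card G.edgeSet + 2
  faceSize_eq : ∀ d, R.faceSize d = 4 ∨ R.faceSize d = 6

end RotationSystem

/-- `c` is a distance-two `r`-coloring of `G`: at every vertex `v`, the colors of `v` and of all its
neighbors are all distinct. -/
def IsDistanceTwoColoring {V : Type*} (G : SimpleGraph V) {r : ℕ} (c : V → Fin r) : Prop :=
  ∀ v, Set.InjOn c (insert v (G.neighborSet v))

/-!
### The graphs `C_k`

Every vertex `s` of the cube is replaced by a triangular piece of the hexagonal lattice with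
`(k + 1) ^ 2` vertices, and along every edge of the cube the two adjacent pieces are joined by
`k + 1` parallel edges. Dually: the boundary of the octahedron `|x| + |y| + |z| ≤ k + 1`, with each of
its eight sides (one for each choice `s` of signs) subdivided into `(k + 1) ^ 2` unit triangles. The
vertices of `C_k` are these triangles, its faces are the integer points with
`|x| + |y| + |z| = k + 1`, and two vertices are adjacent when the triangles share an edge.

In the side `s`, in terms of absolute values of coordinates, the unit triangles are
* for `p` in `ℕ ^ 3` with sum `k`, the triangle with corners `p + e a` for `a = 0, 1, 2`;
* for `p` in `ℕ ^ 3` with sum `k - 1`, the triangle with corners `p + e a + e b` for `a ≠ b`.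
-/

/-- The vertices of `C_k`. In `(s, p)`, the vertex `s` of the cube is the side of the octahedron where
the `a`-th coordinate is nonpositive if `s a` is true and nonnegative otherwise. -/
abbrev GoodeyVertex (k : ℕ) : Type :=
  {v : (Fin 3 → Bool) × (Fin 3 → ℕ) // ∑ a, v.2 a = k ∨ ∑ a, v.2 a + 1 = k}

namespace GoodeyVertex

variable {k : ℕ}

theorem sum_update_pred (p : Fin 3 → ℕ) (a : Fin 3) (h : p a ≠ 0) :
    ∑ b, Function.update p a (p a - 1) b + 1 = ∑ b, p b := by
  fin_cases a <;> simp [Fin.sum_univ_three, Function.update] at h ⊢ <;> omega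

theorem sum_update_succ (p : Fin 3 → ℕ) (a : Fin 3) :
    ∑ b, Function.update p a (p a + 1) b = ∑ b, p b + 1 := by
  fin_cases a <;> simp [Fin.sum_univ_three, Function.update] <;> omega

/-- The neighbor of a vertex in direction `a`: the triangle on the other side of the edge which is
opposite to the corner `p + e a` (if `p` has sum `k`), respectively to the corner
`p + e b + e c` with `{a, b, c} = {0, 1, 2}` (if `p` has sum `k - 1`). -/
def nbr (a : Fin 3) (v : GoodeyVertex k) : GoodeyVertex k :=
  if hk : ∑ b, v.1.2 b = k then
    if h : v.1.2 a = 0 then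
      ⟨(Function.update v.1.1 a (!v.1.1 a), v.1.2), Or.inl hk⟩
    else
      ⟨(v.1.1, Function.update v.1.2 a (v.1.2 a - 1)),
        Or.inr ((sum_update_pred v.1.2 a h).trans hk)⟩
  else
    ⟨(v.1.1, Function.update v.1.2 a (v.1.2 a + 1)),
      Or.inl ((sum_update_succ v.1.2 a).trans (v.2.resolve_left hk))⟩

theorem nbr_val (a : Fin 3) (v : GoodeyVertex k) :
    (nbr a v).1 = if ∑ b, v.1.2 b = k then
      if v.1.2 a = 0 then (Function.update v.1.1 a (!v.1.1 a), v.1.2)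
      else (v.1.1, Function.update v.1.2 a (v.1.2 a - 1))
    else (v.1.1, Function.update v.1.2 a (v.1.2 a + 1)) := by
  by_cases hk : ∑ b, v.1.2 b = k
  · by_cases ha : v.1.2 a = 0
    · rw [nbr, dif_pos hk, dif_pos ha, if_pos hk, if_pos ha]
    · rw [nbr, dif_pos hk, dif_neg ha, if_pos hk, if_neg ha]
  · rw [nbr, dif_neg hk, if_neg hk]

theorem nbr_nbr (a : Fin 3) (v : GoodeyVertex k) : nbr a (nbr a v) = v := by
  apply Subtype.ext
  rw [nbr_val a (nbr a v), nbr_val a v]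
  by_cases hk : ∑ b, v.1.2 b = k
  · by_cases h : v.1.2 a = 0
    · simp [hk, h]
    · have h1 := sum_update_pred v.1.2 a h
      have h2 : ∑ b, Function.update v.1.2 a (v.1.2 a - 1) b ≠ k := by omega
      have h3 : v.1.2 a - 1 + 1 = v.1.2 a := by omega
      simp [hk, h, h2, h3]
  · have h1 := sum_update_succ v.1.2 a
    have h2 : ∑ b, Function.update v.1.2 a (v.1.2 a + 1) b = k :=
      h1.trans (v.2.resolve_left hk)
    simp [hk, h2]

theorem nbr_ne (a : Fin 3) (v : GoodeyVertex k) : nbr a v ≠ v := by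
  intro h
  have h' := congrArg Subtype.val h
  rw [nbr_val] at h'
  have h1 := congrFun (congrArg Prod.fst h') a
  have h2 := congrFun (congrArg Prod.snd h') a
  split_ifs at h1 h2 with hk ha
  · simp at h1
  · simp only [Function.update_self] at h2
    omega
  · simp at h2

theorem nbr_injective (v : GoodeyVertex k) : Function.Injective fun a => nbr a v := by
  intro a b h
  by_contra hab
  have h' := congrArg Subtype.val h
  simp only [nbr_val] at h'
  have h1 := congrFun (congrArg Prod.fst h') a
  have h2 := congrFun (congrArg Prod.snd h') a
  have h3 := congrFun (congrArg Prod.fst h') b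
  split_ifs at h1 h2 h3 with hk ha hb hb
  all_goals simp [Function.update_of_ne hab] at h1 h2 h3
  all_goals omega

/-- The underlying graph of `C_k`. -/
def graph (k : ℕ) : SimpleGraph (GoodeyVertex k) where
  Adj v w := ∃ a, nbr a v = w
  symm := ⟨by rintro v w ⟨a, rfl⟩; exact ⟨a, nbr_nbr a v⟩⟩
  loopless := ⟨by rintro v ⟨a, h⟩; exact nbr_ne a v h⟩

/-- The dart leaving the vertex `x.1` in direction `x.2`. -/
def dart (x : GoodeyVertex k × Fin 3) : (graph k).Dart :=
  ⟨(x.1, nbr x.2 x.1), ⟨x.2, rfl⟩⟩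

theorem dart_bijective : Function.Bijective (dart (k := k)) := by
  constructor
  · rintro ⟨v, a⟩ ⟨w, b⟩ h
    have h' := congrArg SimpleGraph.Dart.toProd h
    simp only [dart, Prod.mk.injEq] at h'
    obtain ⟨rfl, h2⟩ := h'
    rw [nbr_injective v h2]
  · rintro ⟨⟨v, w⟩, ⟨a, h⟩⟩
    refine ⟨(v, a), ?_⟩
    apply SimpleGraph.Dart.ext
    simp only [dart, h]

/-- Whether the side `s` of the octahedron is one where, seen from outside, the directions
`0, 1, 2` are in counterclockwise order, i.e. whether `s` has an even number of minus signs. -/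
def IsPositive (v : GoodeyVertex k) : Prop :=
  (v.1.1 0 ^^ v.1.1 1 ^^ v.1.1 2) = false

instance (v : GoodeyVertex k) : Decidable v.IsPositive :=
  inferInstanceAs (Decidable (_ = _))

/-- The counterclockwise rotation of the pairs (vertex, direction). -/
def turn : Equiv.Perm (GoodeyVertex k × Fin 3) :=
  Equiv.prodShear (Equiv.refl _)
    fun v => if v.IsPositive then Equiv.addRight 1 else Equiv.addRight (-1)

theorem turn_fst (x : GoodeyVertex k × Fin 3) : (turn x).1 = x.1 := rfl

theorem turn_sameCycle (v : GoodeyVertex k) (a b : Fin 3) :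
    (turn (k := k)).SameCycle (v, a) (v, b) := by
  have h1 : ∀ c : Fin 3, turn (k := k) (v, c) = (v, if v.IsPositive then c + 1 else c + (-1)) := by
    intro c
    by_cases h : v.IsPositive <;> simp [turn, h]
  have step : ∀ c : Fin 3, (turn (k := k)).SameCycle (v, c) (turn (v, c)) := fun c => ⟨1, by simp⟩
  have h2 : ∀ c : Fin 3, (turn (k := k)).SameCycle (v, c) (v, c + 1) := by
    intro c
    by_cases h : v.IsPositive
    · simpa [h1, h] using step c
    · have h3 := step (c + 1)
      simp only [h1, h, if_false, add_neg_cancel_right] at h3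
      exact h3.symm
  have h3 : ∀ c : Fin 3, (turn (k := k)).SameCycle (v, 0) (v, c) := by
    intro c
    fin_cases c
    · exact Equiv.Perm.SameCycle.refl _ _
    · exact h2 0
    · exact (h2 0).trans (h2 1)
  exact (h3 a).symm.trans (h3 b)

end GoodeyVertex

/-- The graph `C_k` with its embedding. -/
noncomputable def goodeyC (k : ℕ) : RotationSystem (GoodeyVertex.graph k) where
  rot := (Equiv.ofBijective _ GoodeyVertex.dart_bijective).permCongr GoodeyVertex.turn
  rot_fst d := by
    obtain ⟨x, rfl⟩ := GoodeyVertex.dart_bijective.2 d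
    have h : (Equiv.ofBijective _ GoodeyVertex.dart_bijective).symm (GoodeyVertex.dart x) = x :=
      Equiv.ofBijective_symm_apply_apply _ _ x
    rw [Equiv.permCongr_apply, h]
    rfl
  sameCycle_of_fst_eq d d' hd := by
    obtain ⟨⟨v, a⟩, rfl⟩ := GoodeyVertex.dart_bijective.2 d
    obtain ⟨⟨w, b⟩, rfl⟩ := GoodeyVertex.dart_bijective.2 d'
    obtain rfl : v = w := hd
    obtain ⟨i, hi⟩ := GoodeyVertex.turn_sameCycle v a b
    refine ⟨i, ?_⟩
    have hpow : ((Equiv.ofBijective _ GoodeyVertex.dart_bijective).permCongr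
        (GoodeyVertex.turn (k := k))) ^ i =
        (Equiv.ofBijective _ GoodeyVertex.dart_bijective).permCongr (GoodeyVertex.turn ^ i) :=
      (map_zpow (Equiv.permCongrHom (Equiv.ofBijective _ GoodeyVertex.dart_bijective)) _ i).symm
    have h : (Equiv.ofBijective _ GoodeyVertex.dart_bijective).symm (GoodeyVertex.dart (v, a)) =
        (v, a) := Equiv.ofBijective_symm_apply_apply _ _ (v, a)
    rw [hpow, Equiv.permCongr_apply, h, hi]
    rfl

/-! Suppose a Goodey graph has a distance-two four-coloring. Call an edge cut if, along a face
containing it, the vertices just before and just after it have different colors. All sides of a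
square are cut. Six cyclically arranged colors out of four, any three consecutive ones distinct,
leave only two possibilities for a hexagon: no side is cut, or exactly one pair of opposite sides.
So cut edges line up in straight chains of hexagons leading from square to square, and no hexagon
lies on two crossing chains. `CutSystem` retains just this information.

Take the two chains leaving consecutive sides of a square. As long as neither has met a square, the
sector between them is hexagonal lattice: it is explored across uncut edges, and a square has none
(`CutSystem.sector_spec`). If one chain stopped earlier than the other, its final square would have
an uncut side. Hence the four chains leaving a square have the same number `k` of hexagons, and the
sector is a triangle whose third side is again such a chain (`Corner.far_next_far`). Triangles of
this kind, four around each square, follow the pattern of the octahedron, which yields a map from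
the darts of `C_k` to those of the graph commuting with rotation and reversal (`Corner.dartMap`).

Such a map preserves face sizes and is onto by connectedness. By Euler's formula both graphs have
exactly 24 darts on squares, so the map is injective on those, and injectivity spreads by
connectedness. Thus it is an isomorphism (`IsGoodey.isIsoTo_of_covering`).

Conversely, `C_k` is colored by the Klein four-group: a move in each of the three directions adds
its own nonzero element. That `C_k` is a Goodey graph follows from its explicit facial walks, and
Euler's formula reduces to counting darts on squares. -/

/-- A set of darts of a cubic map all of whose faces are squares or hexagons, with a set of cut
edges that contains all sides of squares, and of each hexagon either no side or a pair of opposite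
sides. -/
structure CutSystem (D : Type*) where
  opp : D → D
  rot : D → D
  sq : D → Prop
  cut : D → Prop
  opp_opp : ∀ d, opp (opp d) = d
  rot_rot_rot : ∀ d, rot (rot (rot d)) = d
  sq_rot_opp : ∀ d, sq (rot (opp d)) ↔ sq d
  four : ∀ d, sq d → rot (opp (rot (opp (rot (opp (rot (opp d))))))) = d
  six : ∀ d, ¬ sq d →
    rot (opp (rot (opp (rot (opp (rot (opp (rot (opp (rot (opp d))))))))))) = d
  cut_opp : ∀ d, cut (opp d) ↔ cut d
  cut_of_sq : ∀ d, sq d → cut d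
  cut_three : ∀ d, ¬ sq d → (cut (rot (opp (rot (opp (rot (opp d)))))) ↔ cut d)
  not_cut_one : ∀ d, ¬ sq d → cut d → ¬ cut (rot (opp d))
  not_cut_two : ∀ d, ¬ sq d → cut d → ¬ cut (rot (opp (rot (opp d))))

/-! ### Straight chains and the hexagonal sector between two of them -/

namespace CutSystem

variable {D : Type*} (S : CutSystem D)

/-- The next dart of the same face. -/
def step (d : D) : D := S.rot (S.opp d)

/-- The previous dart of the same face. -/
def back (d : D) : D := S.opp (S.rot (S.rot d))

/-- Cross the dart `d` and, if the new face is a hexagon, go to its opposite side. -/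
def forward (d : D) : D := S.step (S.step (S.step (S.opp d)))

/-- The parallel translate of `forward` in the direction of the previous dart of the face. -/
def sideways (d : D) : D := S.back (S.back (S.opp (S.back d)))

/-- The darts obtained from the dart `b` by translation in the directions of `b` and `back b`. -/
def sector (b : D) (i j : ℕ) : D := S.sideways^[j] (S.forward^[i] b)

@[simp] theorem step_back (d : D) : S.step (S.back d) = d := by
  simp [step, back, S.opp_opp, S.rot_rot_rot]

@[simp] theorem back_step (d : D) : S.back (S.step d) = d := by
  simp [step, back, S.opp_opp, S.rot_rot_rot]

@[simp] theorem sq_step (d : D) : S.sq (S.step d) ↔ S.sq d := S.sq_rot_opp d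

@[simp] theorem sq_back (d : D) : S.sq (S.back d) ↔ S.sq d := by
  rw [← S.sq_step, S.step_back]

theorem sq_forward (d : D) : S.sq (S.forward d) ↔ S.sq (S.opp d) := by simp [forward]

theorem step_four {d : D} (h : S.sq d) : S.step (S.step (S.step (S.step d))) = d := S.four d h

theorem step_six {d : D} (h : ¬ S.sq d) :
    S.step (S.step (S.step (S.step (S.step (S.step d))))) = d := S.six d h

theorem back_three {d : D} (h : ¬ S.sq d) :
    S.back (S.back (S.back d)) = S.step (S.step (S.step d)) := by
  conv_lhs => rw [← S.step_six h]
  simp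

theorem cut_step_three {d : D} (h : ¬ S.sq d) :
    S.cut (S.step (S.step (S.step d))) ↔ S.cut d := S.cut_three d h

theorem cut_back_three {d : D} (h : ¬ S.sq d) :
    S.cut (S.back (S.back (S.back d))) ↔ S.cut d := by
  rw [S.back_three h, S.cut_step_three h]

theorem not_cut_back {d : D} (h : ¬ S.sq d) (hd : S.cut d) : ¬ S.cut (S.back d) := by
  rw [← S.cut_step_three (by simpa using h), S.step_back]
  exact S.not_cut_two d h hd

theorem not_cut_back_back {d : D} (h : ¬ S.sq d) (hd : S.cut d) :
    ¬ S.cut (S.back (S.back d)) := by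
  rw [← S.cut_step_three (by simpa using h), S.step_back, S.step_back]
  exact S.not_cut_one d h hd

/-- The faces of `d`, `forward d` and `sideways d`, with the face across `sideways d`, form a
rhombus. This identity and the next locate its inner edges; they use only that reversal has order
two and rotation order three, not the sizes of the faces. -/
theorem opp_sideways (d : D) :
    S.opp (S.sideways d) = S.step (S.opp (S.back (S.forward d))) := by
  simp [sideways, step, back, forward, S.opp_opp, S.rot_rot_rot]

theorem opp_back_back_forward (d : D) :
    S.opp (S.back (S.back (S.forward d))) = S.step (S.sideways d) := by
  simp [sideways, step, back, forward, S.opp_opp, S.rot_rot_rot]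

theorem forward_injective : Function.Injective S.forward := by
  have h1 : Function.Injective S.step := Function.LeftInverse.injective S.back_step
  have h2 : Function.Injective S.opp := Function.LeftInverse.injective S.opp_opp
  exact h1.comp (h1.comp (h1.comp h2))

/-- Opposite sides of a hexagon are cut together, so a chain that starts at a cut edge crosses only
cut edges. -/
theorem cut_forward_iterate {b : D} (hb : S.cut b) {n : ℕ}
    (h : ∀ i, 1 ≤ i → i ≤ n → ¬ S.sq (S.forward^[i] b)) :
    ∀ i, i ≤ n → S.cut (S.forward^[i] b)
  | 0, _ => hb
  | i + 1, hi => by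
    have h1 := cut_forward_iterate hb h i (by omega)
    have h2 := h (i + 1) (by omega) hi
    rw [Function.iterate_succ_apply', sq_forward] at h2
    rw [Function.iterate_succ_apply', forward, S.cut_step_three h2, S.cut_opp]
    exact h1

theorem sideways_iterate {b : D} {n : ℕ}
    (h : ∀ i, 1 ≤ i → i ≤ n → ¬ S.sq (S.forward^[i] (S.back b))) :
    ∀ i, i ≤ n → S.sideways^[i] b = S.step (S.forward^[i] (S.back b))
  | 0, _ => by simp
  | i + 1, hi => by
    have h1 := sideways_iterate h i (by omega)
    have h2 := h (i + 1) (by omega) hi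
    rw [Function.iterate_succ_apply', sq_forward] at h2
    rw [Function.iterate_succ_apply', Function.iterate_succ_apply', h1, sideways, forward,
      ← S.back_three h2]
    simp

theorem sector_zero_right (b : D) (i : ℕ) : S.sector b i 0 = S.forward^[i] b := rfl

theorem sector_succ_right (b : D) (i j : ℕ) :
    S.sector b i (j + 1) = S.sideways (S.sector b i j) :=
  Function.iterate_succ_apply' _ _ _

/-- The rows `i = 0` and `j = 0` are the two chains; their hexagons have one cut pair of sides,
hence four uncut sides. Every other face is entered from its neighbors at `(i - 1, j)` and `(i, j -
1)` across two consecutive uncut edges, so it is a hexagon, and the opposite sides are uncut too.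
The last clause says that the two translations commute, which holds because `back` and `step` have
the same cube on hexagons. -/
theorem sector_spec {b : D} (hb : S.sq b) {n m : ℕ}
    (h1 : ∀ i, 1 ≤ i → i ≤ n → ¬ S.sq (S.forward^[i] b))
    (h2 : ∀ j, 1 ≤ j → j ≤ m → ¬ S.sq (S.forward^[j] (S.back b))) :
    ∀ i, i ≤ n → ∀ j, i + j ≤ m → 1 ≤ i + j →
      ¬ S.sq (S.sector b i j) ∧ ¬ S.cut (S.back (S.back (S.sector b i j))) ∧
      (1 ≤ i → ¬ S.cut (S.back (S.sector b i j))) ∧ (1 ≤ j → ¬ S.cut (S.sector b i j)) ∧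
      (∀ i', i = i' + 1 → S.sector b i j = S.forward (S.sector b i' j)) := by
  intro i
  induction i with
  | zero =>
    intro _ j hj hj1
    have e : S.back (S.sector b 0 j) = S.forward^[j] (S.back b) := by
      rw [sector, Function.iterate_zero, id, S.sideways_iterate h2 j (by omega), back_step]
    have e1 : ¬ S.sq (S.back (S.sector b 0 j)) := e ▸ h2 j (by omega) (by omega)
    have e2 : S.cut (S.back (S.sector b 0 j)) :=
      e ▸ S.cut_forward_iterate (S.cut_of_sq _ (by simpa using hb)) h2 j (by omega)
    refine ⟨by simpa using e1, S.not_cut_back e1 e2, by omega, fun _ => ?_, by omega⟩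
    have := S.not_cut_one _ e1 e2
    change ¬ S.cut (S.step _) at this
    simpa using this
  | succ i ih =>
    intro hi j
    induction j with
    | zero =>
      intro hj _
      have e1 := h1 (i + 1) (by omega) hi
      have e2 := S.cut_forward_iterate (S.cut_of_sq _ hb) h1 (i + 1) hi
      refine ⟨e1, S.not_cut_back_back e1 e2, fun _ => S.not_cut_back e1 e2, by omega, ?_⟩
      rintro i' h
      obtain rfl : i = i' := by omega
      exact Function.iterate_succ_apply' _ _ _
    | succ j ihj =>
      intro hj _
      obtain ⟨-, hA2, -, hA4, -⟩ := ih (by omega) (j + 1) (by omega) (by omega)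
      obtain ⟨-, -, hB3, -, hB5⟩ := ihj (by omega) (by omega)
      have hB5 := hB5 i rfl
      have hy : ¬ S.cut (S.opp (S.sector b i (j + 1))) := by
        rw [S.cut_opp]; exact hA4 (by omega)
      have hy' : ¬ S.cut (S.opp (S.back (S.sector b (i + 1) j))) := by
        rw [S.cut_opp]; exact hB3 (by omega)
      have hyy : S.opp (S.sector b i (j + 1)) =
          S.step (S.opp (S.back (S.sector b (i + 1) j))) := by
        rw [S.sector_succ_right, S.opp_sideways, hB5]
      have hs : ¬ S.sq (S.opp (S.sector b i (j + 1))) := fun h => hy (S.cut_of_sq _ h)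
      have e : S.sector b (i + 1) (j + 1) = S.forward (S.sector b i (j + 1)) := by
        rw [forward, ← S.back_three hs, hyy, S.sector_succ_right, sideways, back_step]
      have hs' : ¬ S.sq (S.sector b (i + 1) (j + 1)) := by rwa [e, S.sq_forward]
      refine ⟨hs', ?_, fun _ => ?_, fun _ => ?_, ?_⟩
      -- The third pair of sides is shared with the face at `(i, j + 2)`. It lies on the same
      -- antidiagonal, so the bound `i + j ≤ m` still allows it.
      · obtain ⟨hC1, hC2, -⟩ := ih (by omega) (j + 2) (by omega) (by omega)
        rw [← S.cut_opp, e, S.opp_back_back_forward, ← S.sector_succ_right]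
        rwa [← S.cut_step_three (by simpa using hC1), step_back, step_back] at hC2
      · rw [S.sector_succ_right, sideways]
        rw [S.cut_back_three]
        · exact hy'
        · intro h
          exact hy' (S.cut_of_sq _ h)
      · rw [e, forward, S.cut_step_three hs]
        exact hy
      · rintro i' h
        obtain rfl : i = i' := by omega
        exact e

/-! ### Equality of the lengths of the chains at a square -/

/-- `n` is the number of steps from the square of the dart `b`, straight ahead in the direction
of `b`, to the next square. -/
structure IsLength (b : D) (n : ℕ) : Prop where
  pos : 1 ≤ n
  sq : S.sq (S.forward^[n] b)
  not_sq : ∀ i, 1 ≤ i → i < n → ¬ S.sq (S.forward^[i] b)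

/-- `forward` is injective on a finite set, so its iterates at the latest return to the square of
`b`. -/
theorem exists_isLength [Finite D] {b : D} (hb : S.sq b) : ∃ n, S.IsLength b n := by
  classical
  have hex : ∃ n, 1 ≤ n ∧ S.sq (S.forward^[n] b) := by
    obtain ⟨n, hn, h⟩ := S.forward_injective.mem_periodicPts b
    exact ⟨n, hn, by rw [h.eq]; exact hb⟩
  exact ⟨Nat.find hex, (Nat.find_spec hex).1, (Nat.find_spec hex).2,
    fun i h1 h2 h => Nat.find_min hex h2 ⟨h1, h⟩⟩

/-- If the chain of `b` were the shorter one, the square at its end would share a side with the last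
hexagon `(n - 1, 1)` of the sector; that side is uncut, whereas squares have only cut sides. -/
theorem IsLength.back_le {S : CutSystem D} {b : D} (hb : S.sq b) {n m : ℕ} (hn : S.IsLength b n)
    (hm : S.IsLength (S.back b) m) : m ≤ n := by
  by_contra! hlt
  have hpos := hn.pos
  obtain ⟨k, rfl⟩ : ∃ k, n = k + 1 := ⟨n - 1, by omega⟩
  obtain ⟨h1, h2, -⟩ := S.sector_spec hb (n := k) (m := k + 1)
    (fun i hi1 hi2 => hn.not_sq i hi1 (by omega)) (fun j hj1 hj2 => hm.not_sq j hj1 (by omega))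
    k le_rfl 1 (by omega) (by omega)
  rw [← S.cut_step_three (by simpa using h1), step_back, step_back, S.sector_succ_right,
    ← S.opp_back_back_forward, S.cut_opp] at h2
  apply h2 (S.cut_of_sq _ _)
  rw [S.sector_zero_right, ← Function.iterate_succ_apply' S.forward]
  simpa using hn.sq

/-- Going once around the square closes up four inequalities into equalities. -/
theorem IsLength.back [Finite D] {S : CutSystem D} {b : D} (hb : S.sq b) {n : ℕ}
    (h0 : S.IsLength b n) : S.IsLength (S.back b) n := by
  have hb1 : S.sq (S.back b) := by simpa using hb
  have hb2 : S.sq (S.back (S.back b)) := by simpa using hb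
  have hb3 : S.sq (S.back (S.back (S.back b))) := by simpa using hb
  obtain ⟨n1, h1⟩ := S.exists_isLength hb1
  obtain ⟨n2, h2⟩ := S.exists_isLength hb2
  obtain ⟨n3, h3⟩ := S.exists_isLength hb3
  have h4 : S.IsLength (S.back (S.back (S.back (S.back b)))) n := by
    have : S.back (S.back (S.back (S.back b))) = b := by
      conv_lhs => rw [← S.step_four hb]
      simp
    rwa [this]
  have e1 := h0.back_le hb h1
  have e2 := h1.back_le hb1 h2
  have e3 := h2.back_le hb2 h3
  have e4 := h3.back_le hb3 h4
  obtain rfl : n = n1 := by omega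
  exact h1

/-- A chain can be walked backwards: in a hexagon, three steps and three more steps cancel. -/
theorem IsLength.forward_iterate_opp {S : CutSystem D} {b : D} {k : ℕ}
    (h : S.IsLength b (k + 1)) : ∀ i, i ≤ k →
      S.forward^[i] (S.opp (S.forward^[k] b)) = S.opp (S.forward^[k - i] b)
  | 0, _ => rfl
  | i + 1, hi => by
    rw [Function.iterate_succ_apply', forward_iterate_opp h i (by omega)]
    obtain ⟨j, hj⟩ : ∃ j, k - i = j + 1 := ⟨k - i - 1, by omega⟩
    obtain rfl : j = k - (i + 1) := by omega
    have h1 := h.not_sq (k - i) (by omega) (by omega)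
    rw [hj, Function.iterate_succ_apply', sq_forward] at h1
    rw [hj, Function.iterate_succ_apply', forward, S.opp_opp, forward, S.step_six h1]

theorem IsLength.opp {S : CutSystem D} {b : D} {k : ℕ} (hb : S.sq b)
    (h : S.IsLength b (k + 1)) : S.IsLength (S.opp (S.forward^[k] b)) (k + 1) := by
  refine ⟨h.pos, ?_, fun i hi1 hi2 => ?_⟩
  · rw [Function.iterate_succ_apply', h.forward_iterate_opp k le_rfl, sq_forward, S.opp_opp]
    simpa using hb
  · rw [h.forward_iterate_opp i (by omega), ← S.sq_forward,
      ← Function.iterate_succ_apply' S.forward]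
    exact h.not_sq _ (by omega) (by omega)

/-! ### Corner darts and the octahedral relations between them -/

/-- The darts of squares from which the straight chains have `k` hexagons. -/
def Corner (k : ℕ) : Type _ := {b : D // S.sq b ∧ S.IsLength b (k + 1)}

namespace Corner

variable {S} {k : ℕ}

/-- The corner dart at the other end of the chain, pointing back. -/
def far (b : S.Corner k) : S.Corner k :=
  ⟨S.opp (S.forward^[k] b.1), by
    rw [← S.sq_forward, ← Function.iterate_succ_apply' S.forward]; exact b.2.2.sq,
    b.2.2.opp b.2.1⟩

@[simp] theorem far_far (b : S.Corner k) : far (far b) = b := by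
  apply Subtype.ext
  change S.opp (S.forward^[k] (S.opp (S.forward^[k] b.1))) = b.1
  rw [b.2.2.forward_iterate_opp k le_rfl]
  simp [S.opp_opp]

variable [Finite D]

/-- The previous corner dart of the same square. -/
def prev (b : S.Corner k) : S.Corner k :=
  ⟨S.back b.1, by simpa using b.2.1, b.2.2.back b.2.1⟩

/-- The next corner dart of the same square. -/
def next (b : S.Corner k) : S.Corner k := prev (prev (prev b))

theorem next_val (b : S.Corner k) : (next b).1 = S.step b.1 := by
  change S.back (S.back (S.back b.1)) = _
  conv_lhs => rw [← S.step_four b.2.1]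
  simp

@[simp] theorem next_prev (b : S.Corner k) : next (prev b) = b := by
  apply Subtype.ext
  rw [next_val]
  exact S.step_back _

@[simp] theorem prev_next (b : S.Corner k) : prev (next b) = b := by
  apply Subtype.ext
  change S.back (next b).1 = _
  rw [next_val, S.back_step]

theorem next_four (b : S.Corner k) : next (next (next (next b))) = b := by
  apply Subtype.ext
  simp only [next_val]
  exact S.step_four b.2.1

theorem sideways_iterate (b : S.Corner k) {i : ℕ} (hi : i ≤ k) :
    S.sideways^[i] b.1 = S.step (S.forward^[i] (prev b).1) :=
  S.sideways_iterate (n := k) (fun i h1 h2 => (prev b).2.2.not_sq i h1 (by omega)) i hi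

theorem forward_sector (b : S.Corner k) {i j : ℕ} (h : i + j < k) :
    S.sector b.1 (i + 1) j = S.forward (S.sector b.1 i j) :=
  (S.sector_spec b.2.1 (n := k) (m := k) (fun i h1 h2 => b.2.2.not_sq i h1 (by omega))
    (fun i h1 h2 => (prev b).2.2.not_sq i h1 (by omega)) (i + 1) (by omega) j (by omega)
    (by omega)).2.2.2.2 i rfl

/-- The antidiagonal of the sector is a chain as well, starting from the square at the end of the
chain of `b`. -/
theorem rot_sector_side (b : S.Corner k) : ∀ i j : ℕ, i + j = k →
    S.rot (S.sector b.1 i j) = S.forward^[j] (next (far b)).1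
  | i, 0, h => by
    obtain rfl : i = k := h
    rw [next_val, S.sector_zero_right]
    simp [step, far, S.opp_opp]
  | i, j + 1, h => by
    rw [Function.iterate_succ_apply', ← rot_sector_side b (i + 1) j (by omega),
      b.forward_sector (by omega), S.sector_succ_right]
    simp [sideways, step, back, forward, S.opp_opp, S.rot_rot_rot]

/-- The triangle closes up: its third side ends at the square where the chain of `prev b` ends. This
is the case `i = 0` of `rot_sector_side`. -/
theorem far_next_far (b : S.Corner k) : far (next (far b)) = prev (far (prev b)) := by
  apply Subtype.ext
  change S.opp (S.forward^[k] (next (far b)).1) = S.back (S.opp (S.forward^[k] (prev b).1))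
  rw [← rot_sector_side b 0 k (by omega), sector, Function.iterate_zero, id,
    b.sideways_iterate le_rfl]
  simp [step, back]

/-- The corner corresponding to `b` in the triangle on the other side of the opposite edge. -/
def across (b : S.Corner k) : S.Corner k := far (prev (far (next (far b))))

theorem next_far_across (b : S.Corner k) : next (far (across b)) = far (next (far b)) := by
  simp [across]

theorem across_across (b : S.Corner k) : across (across b) = b := by
  simp [across]

/-- In the octahedron, `across` is the reflection exchanging two antipodal vertices, so it reverses
the cyclic order of the corners. -/
theorem across_next (b : S.Corner k) : across (next b) = prev (across b) := by
  have h : ∀ b : S.Corner k, prev (prev b) = next (next b) := fun b => by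
    conv_lhs => rw [← next_four b]
    simp
  rw [across, across, far_next_far, far_next_far, prev_next, ← far_next_far (prev (far (prev b))),
    ← far_next_far b, far_far, h]

/-! ### Mapping a triangular piece of `C_k` into a sector -/

/-- The darts of the triangle with the corner dart `b`. -/
def piece (b : S.Corner k) (p : Fin 3 → ℕ) (a : Fin 3) : D :=
  S.rot^[a.val] (if ∑ c, p c = k then S.rot (S.sector b.1 (p 1) (p 2))
    else S.opp (S.rot (S.sector b.1 (p 1) (p 2))))

omit [Finite D] in
theorem piece_add_one (b : S.Corner k) (p : Fin 3 → ℕ) (a : Fin 3) :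
    piece b p (a + 1) = S.rot (piece b p a) := by
  fin_cases a <;> simp [piece, S.rot_rot_rot]

/-- Incidences inside a piece: direction 0 holds by definition, direction 1 is a `forward`
translation and direction 2 a `sideways` one. -/
theorem opp_piece_succ (b : S.Corner k) (p : Fin 3 → ℕ) (hp : ∑ c, p c + 1 = k) (a : Fin 3) :
    S.opp (piece b (Function.update p a (p a + 1)) a) = piece b p a := by
  have h1 : ∑ c, Function.update p a (p a + 1) c = k := by
    rw [← hp]
    fin_cases a <;> simp [Fin.sum_univ_three, Function.update] <;> omega
  have h2 : ∑ c, p c ≠ k := by omega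
  have h3 : p 1 + p 2 < k := by rw [Fin.sum_univ_three] at hp; omega
  simp only [piece, h1, h2, if_true, if_false]
  fin_cases a
  · simp
  · have := b.forward_sector h3
    simp [this, forward, step, S.rot_rot_rot, S.opp_opp]
  · simp [sector_succ_right, sideways, back, S.rot_rot_rot, S.opp_opp]

omit [Finite D] in
theorem piece_two (b : S.Corner k) (p : Fin 3 → ℕ) (hp : ∑ c, p c = k) (h : p 2 = 0) :
    piece b p 2 = S.forward^[p 1] b.1 := by
  simp [piece, hp, h, sector_zero_right, S.rot_rot_rot]

theorem piece_one (b : S.Corner k) (p : Fin 3 → ℕ) (hp : ∑ c, p c = k) (h : p 1 = 0) :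
    piece b p 1 = S.opp (S.forward^[p 2] (prev b).1) := by
  have h3 : p 2 ≤ k := by rw [Fin.sum_univ_three] at hp; omega
  have := b.sideways_iterate h3
  simp [piece, hp, h, sector, this, step, S.rot_rot_rot]

theorem piece_zero (b : S.Corner k) (p : Fin 3 → ℕ) (hp : ∑ c, p c = k) (h : p 0 = 0) :
    piece b p 0 = S.forward^[p 2] (next (far b)).1 := by
  have h3 : p 1 + p 2 = k := by rw [Fin.sum_univ_three] at hp; omega
  simp [piece, hp, rot_sector_side b _ _ h3]

theorem sum_neg (p : Fin 3 → ℕ) : ∑ c, p (-c) = ∑ c, p c := by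
  exact Equiv.sum_comp (Equiv.neg (Fin 3)) p

/-- Neighboring sides of the octahedron are mirror images, so the neighboring piece is read through
`c ↦ -c`, which fixes 0 and exchanges 1 and 2. This lemma and the next two glue along the three
sides of a piece. -/
theorem piece_next (b : S.Corner k) (p : Fin 3 → ℕ) (hp : ∑ c, p c = k) (h : p 2 = 0) :
    piece (next b) (fun c => p (-c)) (-2) = S.opp (piece b p 2) := by
  rw [piece_two b p hp h]
  refine (piece_one (next b) (fun c => p (-c)) ((sum_neg p).trans hp) h).trans ?_
  rw [prev_next]
  rfl

theorem piece_prev (b : S.Corner k) (p : Fin 3 → ℕ) (hp : ∑ c, p c = k) (h : p 1 = 0) :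
    piece (prev b) (fun c => p (-c)) (-1) = S.opp (piece b p 1) := by
  rw [piece_one b p hp h, S.opp_opp]
  exact piece_two (prev b) (fun c => p (-c)) ((sum_neg p).trans hp) h

theorem piece_across (b : S.Corner k) (p : Fin 3 → ℕ) (hp : ∑ c, p c = k) (h : p 0 = 0) :
    piece (across b) (fun c => p (-c)) (-0) = S.opp (piece b p 0) := by
  have h3 : p 1 + p 2 = k := by rw [Fin.sum_univ_three] at hp; omega
  rw [piece_zero b p hp h]
  refine (piece_zero (across b) (fun c => p (-c)) ((sum_neg p).trans hp) h).trans ?_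
  rw [next_far_across]
  have h4 : p 2 = k - p 1 := by omega
  rw [h4]
  exact (next (far b)).2.2.forward_iterate_opp (p 1) (by omega)

/-! ### Gluing the eight pieces into a covering -/

/-- The corners of the eight triangles around the corner dart `b`. -/
def side (b : S.Corner k) (s : Fin 3 → Bool) : S.Corner k :=
  (if s 0 then across else id)
    (if s 1 then (if s 2 then next (next b) else prev b) else (if s 2 then next b else b))

theorem prev_prev (b : S.Corner k) : prev (prev b) = next (next b) := by
  conv_lhs => rw [← next_four b]
  simp

theorem next_three (b : S.Corner k) : next (next (next b)) = prev b := by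
  conv_rhs => rw [← next_four b]
  simp

theorem across_prev (b : S.Corner k) : across (prev b) = next (across b) := by
  conv_rhs => rw [← next_prev b, across_next, next_prev]

theorem side_update_zero (b : S.Corner k) (s : Fin 3 → Bool) :
    side b (Function.update s 0 (!s 0)) = across (side b s) := by
  cases h : s 0 <;> simp [side, h, across_across]

/-- Parity matters because the orientation alternates between adjacent sides: from an odd side the
same flip is undone by `next` instead of `prev`. -/
theorem side_update_one (b : S.Corner k) (s : Fin 3 → Bool) (hs : (s 0 ^^ s 1 ^^ s 2) = false) :
    side b (Function.update s 1 (!s 1)) = prev (side b s) := by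
  cases h0 : s 0 <;> cases h1 : s 1 <;> cases h2 : s 2 <;> simp [h0, h1, h2] at hs <;>
    simp [side, h0, h1, h2, across_next, across_prev, prev_prev]

theorem side_update_two (b : S.Corner k) (s : Fin 3 → Bool) (hs : (s 0 ^^ s 1 ^^ s 2) = false) :
    side b (Function.update s 2 (!s 2)) = next (side b s) := by
  cases h0 : s 0 <;> cases h1 : s 1 <;> cases h2 : s 2 <;> simp [h0, h1, h2] at hs <;>
    simp [side, h0, h1, h2, across_next, across_prev, prev_prev, next_three]

/-- The covering of the map with the cut system `S` by `C_k`, on pairs (vertex, direction). -/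
def dartMap (b : S.Corner k) (x : GoodeyVertex k × Fin 3) : D :=
  if x.1.IsPositive then piece (side b x.1.1.1) x.1.1.2 x.2
  else piece (side b x.1.1.1) (fun c => x.1.1.2 (-c)) (-x.2)

theorem dartMap_turn (b : S.Corner k) (x : GoodeyVertex k × Fin 3) :
    dartMap b (GoodeyVertex.turn x) = S.rot (dartMap b x) := by
  obtain ⟨v, a⟩ := x
  by_cases h : v.IsPositive
  · simp [dartMap, GoodeyVertex.turn, h, piece_add_one]
  · simp only [dartMap, GoodeyVertex.turn, h, if_false, Equiv.prodShear_apply, Equiv.refl_apply,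
      Equiv.coe_addRight, ← piece_add_one]
    congr 1
    abel

theorem dartMap_nbr_of_down (b : S.Corner k) (v : GoodeyVertex k) (a : Fin 3)
    (hv : ∑ c, v.1.2 c ≠ k) :
    S.opp (dartMap b (GoodeyVertex.nbr a v, a)) = dartMap b (v, a) := by
  have hv' := v.2.resolve_left hv
  have e := GoodeyVertex.nbr_val a v
  rw [if_neg hv] at e
  have hp : (GoodeyVertex.nbr a v).IsPositive ↔ v.IsPositive := by
    simp only [GoodeyVertex.IsPositive, e]
  simp only [dartMap, hp, e]
  split_ifs with h
  · exact opp_piece_succ _ _ hv' a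
  · rw [← opp_piece_succ _ _ ((congrArg (· + 1) (sum_neg v.1.2)).trans hv')]
    congr 2
    funext c
    simp only [Function.update_apply, neg_neg, neg_eq_iff_eq_neg]

/-- Crossing an edge of the octahedron joins a positive side to a negative one. Starting from the
positive side suffices, since `nbr a` is an involution. -/
theorem dartMap_nbr_of_flip (b : S.Corner k) (v : GoodeyVertex k) (a : Fin 3)
    (hv : ∑ c, v.1.2 c = k) (ha : v.1.2 a = 0) (h : v.IsPositive) :
    dartMap b (GoodeyVertex.nbr a v, a) = S.opp (dartMap b (v, a)) := by
  have e := GoodeyVertex.nbr_val a v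
  rw [if_pos hv, if_pos ha] at e
  have hp : ¬ (GoodeyVertex.nbr a v).IsPositive := by
    unfold GoodeyVertex.IsPositive at h ⊢
    rw [e]
    revert h
    generalize v.1.1 = s
    fin_cases a <;> cases h0 : s 0 <;> cases h1 : s 1 <;> cases h2 : s 2 <;>
      simp [h0, h1, h2]
  simp only [dartMap, hp, h, e, if_true, if_false]
  fin_cases a
  · exact (congrArg (fun c => piece c _ _) (side_update_zero b v.1.1)).trans
      (piece_across _ _ hv ha)
  · exact (congrArg (fun c => piece c _ _) (side_update_one b v.1.1 h)).trans
      (piece_prev _ _ hv ha)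
  · exact (congrArg (fun c => piece c _ _) (side_update_two b v.1.1 h)).trans
      (piece_next _ _ hv ha)

theorem dartMap_nbr (b : S.Corner k) (v : GoodeyVertex k) (a : Fin 3) :
    dartMap b (GoodeyVertex.nbr a v, a) = S.opp (dartMap b (v, a)) := by
  by_cases hv : ∑ c, v.1.2 c = k
  · have e := GoodeyVertex.nbr_val a v
    rw [if_pos hv] at e
    by_cases ha : v.1.2 a = 0
    · by_cases h : v.IsPositive
      · exact dartMap_nbr_of_flip b v a hv ha h
      · rw [if_pos ha] at e
        have h' : (GoodeyVertex.nbr a v).IsPositive := by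
          unfold GoodeyVertex.IsPositive at h ⊢
          rw [e]
          revert h
          generalize v.1.1 = s
          fin_cases a <;> cases h0 : s 0 <;> cases h1 : s 1 <;> cases h2 : s 2 <;>
            simp [h0, h1, h2]
        have := dartMap_nbr_of_flip b (GoodeyVertex.nbr a v) a (by rw [e]; exact hv)
          (by rw [e]; exact ha) h'
        rw [GoodeyVertex.nbr_nbr] at this
        rw [this, S.opp_opp]
    · rw [if_neg ha] at e
      have := dartMap_nbr_of_down b (GoodeyVertex.nbr a v) a (by
        rw [e]
        have := GoodeyVertex.sum_update_pred v.1.2 a ha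
        change ∑ c, Function.update v.1.2 a (v.1.2 a - 1) c ≠ k
        omega)
      rw [GoodeyVertex.nbr_nbr] at this
      exact this.symm
  · rw [← dartMap_nbr_of_down b v a hv, S.opp_opp]

end Corner

end CutSystem

/-! ### Counting darts and faces; Euler's formula -/

theorem Equiv.Perm.minimalPeriod_eq_ncard_sameCycle {α : Type*} [Finite α] (f : Equiv.Perm α)
    (x : α) : Function.minimalPeriod f x = {y | f.SameCycle x y}.ncard := by
  classical
  have := Fintype.ofFinite α
  have h := MulAction.minimalPeriod_eq_card (a := f) (b := x)
  rw [show ((f • ·) : α → α) = f from rfl, ← Nat.card_eq_fintype_card] at h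
  rw [h, ← Nat.card_coe_set_eq]
  refine Nat.card_congr (Equiv.setCongr ?_)
  ext y
  simp only [MulAction.mem_orbit_iff, Set.mem_ofPred_eq, Equiv.Perm.SameCycle]
  constructor
  · rintro ⟨⟨_, n, rfl⟩, rfl⟩
    exact ⟨n, rfl⟩
  · rintro ⟨n, rfl⟩
    exact ⟨⟨f ^ n, n, rfl⟩, rfl⟩

namespace RotationSystem

variable {V : Type*} {G : SimpleGraph V} (R : RotationSystem G)

theorem faceStep_apply (d : G.Dart) : R.faceStep d = R.rot d.symm := rfl

theorem rot_zpow_fst (d : G.Dart) (n : ℤ) : ((R.rot ^ n) d).fst = d.fst := by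
  have h : ∀ (n : ℕ) (d : G.Dart), ((R.rot ^ n) d).fst = d.fst := by
    intro n
    induction n with
    | zero => intro d; rfl
    | succ n ih => intro d; rw [pow_succ, Equiv.Perm.mul_apply, ih, R.rot_fst]
  cases n with
  | ofNat n => exact h n d
  | negSucc n =>
    rw [zpow_negSucc, ← h (n + 1) ((R.rot ^ (n + 1))⁻¹ d), ← Equiv.Perm.mul_apply, mul_inv_cancel]
    rfl

theorem sameCycle_rot_iff (d d' : G.Dart) : R.rot.SameCycle d d' ↔ d'.fst = d.fst := by
  constructor
  · rintro ⟨n, rfl⟩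
    exact R.rot_zpow_fst d n
  · intro h
    exact R.sameCycle_of_fst_eq d d' h.symm

theorem ncard_dart_fst (v : V) : {d : G.Dart | d.fst = v}.ncard = (G.neighborSet v).ncard := by
  symm
  refine Set.ncard_congr (fun w hw => ⟨(v, w), hw⟩) (fun w hw => rfl) ?_ ?_
  · intro a b ha hb h
    simpa using congrArg (fun d : G.Dart => d.snd) h
  · rintro ⟨⟨a, b⟩, h⟩ (rfl : a = v)
    exact ⟨b, h, rfl⟩

section Cubic

variable [Finite V] (hc : ∀ v, (G.neighborSet v).ncard = 3)

instance : Finite G.Dart :=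
  Finite.of_injective (fun d => d.toProd) SimpleGraph.Dart.toProd_injective

include hc

theorem minimalPeriod_rot (d : G.Dart) : Function.minimalPeriod R.rot d = 3 := by
  rw [Equiv.Perm.minimalPeriod_eq_ncard_sameCycle]
  simp only [R.sameCycle_rot_iff]
  rw [ncard_dart_fst, hc]

theorem rot_rot_rot (d : G.Dart) : R.rot (R.rot (R.rot d)) = d := by
  have h := Function.isPeriodicPt_minimalPeriod R.rot d
  rw [R.minimalPeriod_rot hc] at h
  exact h

theorem rot_ne (d : G.Dart) : R.rot d ≠ d := by
  intro h
  have h1 : Function.IsPeriodicPt R.rot 1 d := h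
  have h2 := h1.minimalPeriod_le one_pos
  rw [R.minimalPeriod_rot hc] at h2
  omega

theorem rot_rot_ne (d : G.Dart) : R.rot (R.rot d) ≠ d := by
  intro h
  have h1 := R.rot_rot_rot hc d
  rw [h] at h1
  exact R.rot_ne hc d h1

theorem three_mul_card : 3 * Nat.card V = Nat.card G.Dart := by
  classical
  have := Fintype.ofFinite V
  rw [Nat.card_eq_fintype_card, Nat.card_eq_fintype_card, G.dart_card_eq_sum_degrees,
    Finset.sum_congr rfl (g := fun _ => 3)]
  · simp [mul_comm]
  · intro v _
    rw [← hc v, ← Nat.card_coe_set_eq, Nat.card_eq_fintype_card,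
      SimpleGraph.card_neighborSet_eq_degree]

omit hc in
theorem card_dart : Nat.card G.Dart = 2 * Nat.card G.edgeSet := by
  classical
  have := Fintype.ofFinite V
  rw [Nat.card_eq_fintype_card, G.dart_card_eq_twice_card_edges, Nat.card_eq_fintype_card,
    SimpleGraph.edgeFinset_card]

omit hc in
theorem faceSize_eq_of_sameCycle {d d' : G.Dart} (h : R.faceStep.SameCycle d d') :
    R.faceSize d = R.faceSize d' := by
  rw [faceSize, faceSize, Equiv.Perm.minimalPeriod_eq_ncard_sameCycle,
    Equiv.Perm.minimalPeriod_eq_ncard_sameCycle]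
  congr 1
  ext x
  exact ⟨fun hx => h.symm.trans hx, fun hx => h.trans hx⟩

-- Give each dart the weight 12 divided by the size of its face: 3 on a square, 2 on a hexagon. Each
-- face then has total weight 12.
omit hc in
theorem twelve_mul_card_face (hs : ∀ d, R.faceSize d = 4 ∨ R.faceSize d = 6) :
    12 * Nat.card R.Face = 2 * Nat.card G.Dart + {d | R.faceSize d = 4}.ncard := by
  classical
  have := Fintype.ofFinite G.Dart
  have : Finite R.Face := Quotient.finite _
  have := Fintype.ofFinite R.Face
  let q : G.Dart → R.Face := Quotient.mk _
  have h1 : ∑ d : G.Dart, 12 / R.faceSize d =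
      2 * Nat.card G.Dart + {d | R.faceSize d = 4}.ncard := by
    have e : {d | R.faceSize d = 4} =
        ((Finset.univ.filter fun d => R.faceSize d = 4 : Finset G.Dart) : Set G.Dart) := by
      ext; simp
    rw [e, Set.ncard_coe_finset, Finset.card_filter, Nat.card_eq_fintype_card, Fintype.card,
      Finset.card_eq_sum_ones, Finset.mul_sum, ← Finset.sum_add_distrib]
    refine Finset.sum_congr rfl fun d _ => ?_
    rcases hs d with h | h <;> simp [h]
  rw [← h1, ← Finset.sum_fiberwise (s := Finset.univ) (g := q), Nat.card_eq_fintype_card,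
    Fintype.card, Finset.card_eq_sum_ones, Finset.mul_sum]
  refine Finset.sum_congr rfl fun f _ => ?_
  obtain ⟨d, rfl⟩ := Quotient.exists_rep f
  have h2 : ∀ d' ∈ Finset.univ.filter (fun d' => q d' = q d),
      12 / R.faceSize d' = 12 / R.faceSize d := by
    intro d' hd'
    rw [R.faceSize_eq_of_sameCycle (Quotient.exact (Finset.mem_filter.1 hd').2)]
  have h3 : (Finset.univ.filter fun d' => q d' = q d).card = R.faceSize d := by
    rw [faceSize, Equiv.Perm.minimalPeriod_eq_ncard_sameCycle, ← Set.ncard_coe_finset]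
    congr 1
    ext x
    simp only [Finset.coe_filter, Finset.mem_univ, true_and, Set.mem_ofPred_eq]
    exact ⟨fun h => (Quotient.exact h : R.faceStep.SameCycle x d).symm,
      fun h => Quotient.sound (show R.faceStep.SameCycle x d from h.symm)⟩
  change 12 * 1 = ∑ d' ∈ Finset.univ.filter (fun d' => q d' = q d), _
  rw [Finset.sum_congr rfl h2, Finset.sum_const, h3]
  rcases hs d with h | h <;> simp [h]

/-- In a cubic map hexagons contribute nothing to the Euler characteristic, so it only counts
squares: six of them, with four darts each. -/
theorem euler_iff (hs : ∀ d, R.faceSize d = 4 ∨ R.faceSize d = 6) :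
    Nat.card V + Nat.card R.Face = Nat.card G.edgeSet + 2 ↔
      {d | R.faceSize d = 4}.ncard = 24 := by
  have h1 := three_mul_card hc
  have h2 := card_dart (G := G)
  have h3 := R.twelve_mul_card_face hs
  omega

end Cubic

/-- A nonempty set of darts of a connected graph which is closed under rotation and reversal
contains all darts. -/
theorem dart_induction (hG : G.Connected) {P : G.Dart → Prop} (d₀ : G.Dart) (h₀ : P d₀)
    (hrot : ∀ d, P d → P (R.rot d)) (hrot' : ∀ d, P (R.rot d) → P d)
    (hsymm : ∀ d, P d → P d.symm) (d : G.Dart) : P d := by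
  have h1 : ∀ d d' : G.Dart, d.fst = d'.fst → P d → P d' := by
    intro d d' h hd
    obtain ⟨n, rfl⟩ := R.sameCycle_of_fst_eq d d' h
    have : ∀ (n : ℕ) (d : G.Dart), P ((R.rot ^ n) d) ↔ P d := by
      intro n
      induction n with
      | zero => intro d; rfl
      | succ n ih =>
        intro d
        rw [pow_succ, Equiv.Perm.mul_apply, ih]
        exact ⟨hrot' d, hrot d⟩
    cases n with
    | ofNat n => exact (this n d).2 hd
    | negSucc n =>
      rw [zpow_negSucc, ← this (n + 1), ← Equiv.Perm.mul_apply, mul_inv_cancel]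
      exact hd
  have h2 : ∀ {u v : V} (w : G.Walk u v), (∀ d : G.Dart, d.fst = u → P d) →
      ∀ d : G.Dart, d.fst = v → P d := by
    intro u v w
    induction w with
    | nil => exact id
    | cons h _ ih =>
      intro hu
      exact ih fun d hd => h1 (⟨(_, _), h⟩ : G.Dart).symm d hd.symm (hsymm _ (hu _ rfl))
  obtain ⟨w⟩ := hG.preconnected d₀.fst d.fst
  exact h2 w (fun d' hd' => h1 d₀ d' hd'.symm h₀) d rfl

/-! ### Exact face sizes in bipartite cubic maps -/

variable {V : Type*} {G : SimpleGraph V} (R : RotationSystem G)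

theorem faceSize_faceStep [Finite V] (d : G.Dart) : R.faceSize (R.faceStep d) = R.faceSize d :=
  R.faceSize_eq_of_sameCycle (Equiv.Perm.SameCycle.symm ⟨1, by simp⟩)

theorem faceStep_faceStep_ne [Finite V] (hc : ∀ v, (G.neighborSet v).ncard = 3) (d : G.Dart) :
    R.faceStep (R.faceStep d) ≠ d := by
  intro h
  apply R.rot_ne hc d.symm
  have h1 := congrArg (fun d : G.Dart => d.fst) h
  simp only [faceStep_apply, R.rot_fst] at h1
  apply SimpleGraph.Dart.ext
  apply Prod.ext
  · exact R.rot_fst _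
  · exact h1

theorem even_of_isPeriodicPt {p : V → Bool} (hp : ∀ u v, G.Adj u v → p v = !p u) {n : ℕ}
    {d : G.Dart} (h : Function.IsPeriodicPt R.faceStep n d) : Even n := by
  have key : ∀ n, p (R.faceStep^[n] d).fst = (p d.fst ^^ decide (¬ Even n)) := by
    intro n
    induction n with
    | zero => simp
    | succ n ih =>
      rw [Function.iterate_succ_apply']
      generalize R.faceStep^[n] d = e at ih ⊢
      rw [faceStep_apply, R.rot_fst]
      change p e.snd = _
      rw [hp _ _ e.adj, ih]
      by_cases hn : Even n <;> simp [hn, Nat.even_add_one]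
  have h1 := key n
  rw [h.eq] at h1
  by_contra hn
  simp [hn] at h1

/-- The period divides 4, is even by bipartiteness, and is not 2 because a facial walk does not turn
back in a cubic graph. The same argument works for 6. -/
theorem faceSize_eq_four [Finite V] (hc : ∀ v, (G.neighborSet v).ncard = 3) {p : V → Bool}
    (hp : ∀ u v, G.Adj u v → p v = !p u) {d : G.Dart}
    (h : Function.IsPeriodicPt R.faceStep 4 d) : R.faceSize d = 4 := by
  have h1 := h.minimalPeriod_dvd
  have h2 := R.even_of_isPeriodicPt hp (Function.isPeriodicPt_minimalPeriod R.faceStep d)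
  have h3 := Function.isPeriodicPt_minimalPeriod R.faceStep d
  change Function.minimalPeriod R.faceStep d = 4
  have h4 := Nat.le_of_dvd (by norm_num) h1
  generalize Function.minimalPeriod R.faceStep d = m at *
  have h5 : m ≠ 2 := by rintro rfl; exact R.faceStep_faceStep_ne hc d h3
  interval_cases m <;> simp_all +decide

theorem faceSize_eq_six [Finite V] (hc : ∀ v, (G.neighborSet v).ncard = 3) {p : V → Bool}
    (hp : ∀ u v, G.Adj u v → p v = !p u) {d : G.Dart}
    (h : Function.IsPeriodicPt R.faceStep 6 d) : R.faceSize d = 6 := by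
  have h1 := h.minimalPeriod_dvd
  have h2 := R.even_of_isPeriodicPt hp (Function.isPeriodicPt_minimalPeriod R.faceStep d)
  have h3 := Function.isPeriodicPt_minimalPeriod R.faceStep d
  change Function.minimalPeriod R.faceStep d = 6
  have h4 := Nat.le_of_dvd (by norm_num) h1
  generalize Function.minimalPeriod R.faceStep d = m at *
  have h5 : m ≠ 2 := by rintro rfl; exact R.faceStep_faceStep_ne hc d h3
  interval_cases m <;> simp_all +decide

end RotationSystem

/-! ### `C_k` is a Goodey graph -/

namespace GoodeyVertex

variable {k : ℕ}

instance : Finite (GoodeyVertex k) := by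
  have h : ∀ (v : GoodeyVertex k) (a : Fin 3), v.1.2 a < k + 1 := by
    rintro ⟨⟨s, p⟩, hp⟩ a
    simp only [Fin.sum_univ_three] at hp
    change p a < k + 1
    fin_cases a <;> simp <;> omega
  refine Finite.of_injective
    (fun v : GoodeyVertex k => (v.1.1, fun a => (⟨v.1.2 a, h v a⟩ : Fin (k + 1)))) ?_
  intro v w hvw
  simp only [Prod.mk.injEq] at hvw
  apply Subtype.ext
  apply Prod.ext hvw.1
  funext a
  exact congrArg Fin.val (congrFun hvw.2 a)

theorem ncard_neighborSet (v : GoodeyVertex k) : ((graph k).neighborSet v).ncard = 3 := by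
  have : (graph k).neighborSet v = Set.range fun a => nbr a v := rfl
  rw [this, ← Set.image_univ, Set.ncard_image_of_injective _ (nbr_injective v), Set.ncard_univ]
  simp

/-- The vertex of the side `s` at the corner `a`. -/
def corner (k : ℕ) (s : Fin 3 → Bool) (a : Fin 3) : GoodeyVertex k :=
  ⟨(s, Pi.single a k), Or.inl (by simp)⟩

theorem adj_nbr (a : Fin 3) (v : GoodeyVertex k) : (graph k).Adj v (nbr a v) := ⟨a, rfl⟩

/-- Within a side, lowering another nonzero coordinate and then raising coordinate `a` moves a
triangle towards the corner `a`. -/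
theorem reachable_corner (a : Fin 3) (v : GoodeyVertex k) :
    (graph k).Reachable v (corner k v.1.1 a) := by
  have up : ∀ (n : ℕ) (v : GoodeyVertex k), ∑ b, v.1.2 b = k → k - v.1.2 a = n →
      (graph k).Reachable v (corner k v.1.1 a) := by
    intro n
    induction n with
    | zero =>
      intro v hv hn
      have : v = corner k v.1.1 a := by
        apply Subtype.ext
        refine Prod.ext rfl (funext fun b => ?_)
        rw [Fin.sum_univ_three] at hv
        simp only [corner, Pi.single_apply]
        fin_cases a <;> fin_cases b <;> simp at hn ⊢ <;> omega
      exact this ▸ SimpleGraph.Reachable.refl _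
    | succ n ih =>
      intro v hv hn
      obtain ⟨b, hba, hb⟩ : ∃ b, b ≠ a ∧ v.1.2 b ≠ 0 := by
        by_contra! h
        rw [Fintype.sum_eq_single a h] at hv
        omega
      have e1 := nbr_val b v
      rw [if_pos hv, if_neg hb] at e1
      have s1 := sum_update_pred v.1.2 b hb
      have e2 := nbr_val a (nbr b v)
      rw [if_neg (by rw [e1]; change ∑ c, Function.update v.1.2 b (v.1.2 b - 1) c ≠ k; omega),
        e1] at e2
      have s2 := sum_update_succ (Function.update v.1.2 b (v.1.2 b - 1)) a
      have h := ih (nbr a (nbr b v)) (by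
        rw [e2]
        change ∑ c, Function.update (Function.update v.1.2 b (v.1.2 b - 1)) a
          (Function.update v.1.2 b (v.1.2 b - 1) a + 1) c = k
        omega)
        (by
          have : (nbr a (nbr b v)).1.2 a = v.1.2 a + 1 := by
            rw [e2]; simp [Function.update_of_ne hba.symm]
          omega)
      rw [e2] at h
      exact ((adj_nbr b v).reachable.trans (adj_nbr a _).reachable).trans h
  by_cases hv : ∑ b, v.1.2 b = k
  · exact up _ v hv rfl
  · have e := nbr_val a v
    rw [if_neg hv] at e
    have h := up _ (nbr a v) (by
      rw [e]; exact (sum_update_succ v.1.2 a).trans (v.2.resolve_left hv)) rfl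
    rw [e] at h
    exact (adj_nbr a v).reachable.trans h

/-- At the corner `a + 1` the coordinate `a` vanishes, so there direction `a` leads to the adjacent
side. -/
theorem reachable_flip (s : Fin 3 → Bool) (a : Fin 3) :
    (graph k).Reachable (corner k s 0) (corner k (Function.update s a (!s a)) 0) := by
  have h := adj_nbr a (corner k s (a + 1))
  have ha : (corner k s (a + 1)).1.2 a = 0 := by
    change (Pi.single (a + 1) k : Fin 3 → ℕ) a = 0
    rw [Pi.single_eq_of_ne]
    fin_cases a <;> decide
  have e := nbr_val a (corner k s (a + 1))
  rw [if_pos (by simp [corner]), if_pos ha] at e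
  have e' : nbr a (corner k s (a + 1)) = corner k (Function.update s a (!s a)) (a + 1) :=
    Subtype.ext e
  rw [e'] at h
  exact ((reachable_corner (a + 1) (corner k s 0)).trans h.reachable).trans
    (reachable_corner 0 (corner k _ (a + 1)))

theorem connected : (graph k).Connected := by
  have h : ∀ s : Fin 3 → Bool, (graph k).Reachable (corner k s 0) (corner k (fun _ => false) 0) := by
    have h1 : ∀ (a : Fin 3) (s : Fin 3 → Bool),
        (graph k).Reachable (corner k s 0) (corner k (Function.update s a false) 0) := by
      intro a s
      cases hs : s a
      · rw [← hs, Function.update_eq_self]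
      · simpa [hs] using reachable_flip (k := k) s a
    intro s
    have := ((h1 0 s).trans (h1 1 _)).trans (h1 2 _)
    convert this using 2
    funext a
    fin_cases a <;> rfl
  have : Nonempty (GoodeyVertex k) := ⟨corner k (fun _ => false) 0⟩
  refine ⟨fun v w => ?_⟩
  exact ((reachable_corner 0 v).trans (h _)).trans ((reachable_corner 0 w).trans (h _)).symm

/-- The two classes of the bipartition of `C_k`. -/
def parity (v : GoodeyVertex k) : Bool :=
  v.1.1 0 ^^ v.1.1 1 ^^ v.1.1 2 ^^ decide (∑ a, v.1.2 a = k)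

theorem xor_update (s : Fin 3 → Bool) (a : Fin 3) :
    (Function.update s a (!s a) 0 ^^ Function.update s a (!s a) 1 ^^
      Function.update s a (!s a) 2) = !(s 0 ^^ s 1 ^^ s 2) := by
  fin_cases a <;> cases h0 : s 0 <;> cases h1 : s 1 <;> cases h2 : s 2 <;> simp [h0, h1, h2]

theorem parity_nbr (a : Fin 3) (v : GoodeyVertex k) : parity (nbr a v) = !parity v := by
  have e := nbr_val a v
  rw [parity, e, parity]
  split_ifs with hk ha
  · have := xor_update v.1.1 a
    simp only at this ⊢
    rw [this]
    simp
  · have := sum_update_pred v.1.2 a ha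
    have h : ∑ b, Function.update v.1.2 a (v.1.2 a - 1) b ≠ k := by omega
    simp [hk, h]
  · have h := (sum_update_succ v.1.2 a).trans (v.2.resolve_left hk)
    simp [hk, h]

theorem parity_of_adj (v w : GoodeyVertex k) (h : (graph k).Adj v w) : parity w = !parity v := by
  obtain ⟨a, rfl⟩ := h
  exact parity_nbr a v

theorem dart_symm (v : GoodeyVertex k) (a : Fin 3) : (dart (v, a)).symm = dart (nbr a v, a) := by
  apply SimpleGraph.Dart.ext
  simp [dart, nbr_nbr, SimpleGraph.Dart.symm]

theorem rot_dart (x : GoodeyVertex k × Fin 3) : (goodeyC k).rot (dart x) = dart (turn x) := by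
  have h : (Equiv.ofBijective _ dart_bijective).symm (dart x) = x :=
    Equiv.ofBijective_symm_apply_apply _ _ x
  change (Equiv.ofBijective _ dart_bijective).permCongr turn (dart x) = _
  rw [Equiv.permCongr_apply, h]
  rfl

theorem faceStep_dart (v : GoodeyVertex k) (a : Fin 3) :
    (goodeyC k).faceStep (dart (v, a)) = dart (turn (nbr a v, a)) := by
  rw [RotationSystem.faceStep_apply, dart_symm, rot_dart]

/-- The direction after `a` in the rotation at the vertices of the side `s`. -/
def nextDir (s : Fin 3 → Bool) (a : Fin 3) : Fin 3 :=
  if (s 0 ^^ s 1 ^^ s 2) = false then a + 1 else a + 2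

theorem turn_eq (v : GoodeyVertex k) (a : Fin 3) : turn (v, a) = (v, nextDir v.1.1 a) := by
  by_cases h : v.IsPositive
  · have h' := h
    unfold IsPositive at h'
    simp [turn, h, nextDir, h']
  · have h' := h
    unfold IsPositive at h'
    simp only [turn, h, nextDir, h', if_false, Equiv.prodShear_apply, Equiv.refl_apply,
      Equiv.coe_addRight]
    rfl

/-- Flipping a sign reverses the orientation, and the inverse of a 3-cycle is its square. -/
theorem nextDir_update (s : Fin 3 → Bool) (a b : Fin 3) :
    nextDir (Function.update s a (!s a)) b = nextDir s (nextDir s b) := by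
  simp only [nextDir, xor_update]
  cases (s 0 ^^ s 1 ^^ s 2) <;> fin_cases b <;> rfl

theorem nextDir_three (s : Fin 3 → Bool) (a : Fin 3) :
    nextDir s (nextDir s (nextDir s a)) = a := by
  simp only [nextDir]
  cases (s 0 ^^ s 1 ^^ s 2) <;> fin_cases a <;> rfl

theorem nextDir_ne (s : Fin 3 → Bool) (a : Fin 3) : nextDir s a ≠ a := by
  simp only [nextDir]
  cases (s 0 ^^ s 1 ^^ s 2) <;> fin_cases a <;> decide

/-- The face step of `C_k` in coordinates. -/
def rawStep (k : ℕ) (x : (Fin 3 → Bool) × (Fin 3 → ℕ) × Fin 3) :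
    (Fin 3 → Bool) × (Fin 3 → ℕ) × Fin 3 :=
  if ∑ b, x.2.1 b = k then
    if x.2.1 x.2.2 = 0 then
      (Function.update x.1 x.2.2 (!x.1 x.2.2), x.2.1, nextDir x.1 (nextDir x.1 x.2.2))
    else (x.1, Function.update x.2.1 x.2.2 (x.2.1 x.2.2 - 1), nextDir x.1 x.2.2)
  else (x.1, Function.update x.2.1 x.2.2 (x.2.1 x.2.2 + 1), nextDir x.1 x.2.2)

/-- The coordinates of a dart. -/
def raw (x : GoodeyVertex k × Fin 3) : (Fin 3 → Bool) × (Fin 3 → ℕ) × Fin 3 :=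
  (x.1.1.1, x.1.1.2, x.2)

theorem raw_injective : Function.Injective (raw (k := k)) := by
  rintro ⟨v, a⟩ ⟨w, b⟩ h
  simp only [raw, Prod.mk.injEq] at h
  exact Prod.ext (Subtype.ext (Prod.ext h.1 h.2.1)) h.2.2

theorem raw_turn_nbr (v : GoodeyVertex k) (a : Fin 3) :
    raw (turn (nbr a v, a)) = rawStep k (raw (v, a)) := by
  rw [turn_eq, raw, nbr_val, raw, rawStep]
  split_ifs
  · simp [nextDir_update]
  · rfl
  · rfl

theorem faceStep_iterate_dart (n : ℕ) (x : GoodeyVertex k × Fin 3) :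
    ∃ y, (goodeyC k).faceStep^[n] (dart x) = dart y ∧ raw y = (rawStep k)^[n] (raw x) := by
  induction n with
  | zero => exact ⟨x, rfl, rfl⟩
  | succ n ih =>
    obtain ⟨⟨v, a⟩, h1, h2⟩ := ih
    refine ⟨turn (nbr a v, a), ?_, ?_⟩
    · rw [Function.iterate_succ_apply', h1, faceStep_dart]
    · rw [Function.iterate_succ_apply', ← h2, raw_turn_nbr]

theorem isPeriodicPt_of_rawStep {n : ℕ} {x : GoodeyVertex k × Fin 3}
    (h : (rawStep k)^[n] (raw x) = raw x) :
    Function.IsPeriodicPt (goodeyC k).faceStep n (dart x) := by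
  obtain ⟨y, h1, h2⟩ := faceStep_iterate_dart n x
  rw [h] at h2
  rw [raw_injective h2] at h1
  exact h1

/-- The vector with the coordinates `x`, `y`, `z` in the directions `a`, `nextDir s a` and
`nextDir s (nextDir s a)`. -/
def coords (s : Fin 3 → Bool) (a : Fin 3) (x y z : ℕ) : Fin 3 → ℕ :=
  fun i => if i = a then x else if i = nextDir s a then y else z

section Coords

variable (s : Fin 3 → Bool) (a : Fin 3) (x y z w : ℕ)

theorem eq_coords (p : Fin 3 → ℕ) :
    p = coords s a (p a) (p (nextDir s a)) (p (nextDir s (nextDir s a))) := by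
  funext i
  simp only [coords, nextDir]
  by_cases h : (s 0 ^^ s 1 ^^ s 2) = false <;> simp only [h, if_true] <;>
    fin_cases a <;> fin_cases i <;> rfl

@[simp] theorem sum_coords : ∑ i, coords s a x y z i = x + y + z := by
  simp only [coords, nextDir, Fin.sum_univ_three]
  by_cases h : (s 0 ^^ s 1 ^^ s 2) = false <;> simp only [h, if_true] <;>
    fin_cases a <;> simp +decide <;> omega

@[simp] theorem coords_first : coords s a x y z a = x := by simp [coords]

@[simp] theorem coords_second : coords s a x y z (nextDir s a) = y := by
  simp [coords, nextDir_ne]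

@[simp] theorem coords_third : coords s a x y z (nextDir s (nextDir s a)) = z := by
  have h : nextDir s (nextDir s a) ≠ a := by
    intro h
    have := nextDir_three s a
    rw [h] at this
    exact nextDir_ne s a this
  simp [coords, nextDir_ne, h]

@[simp] theorem update_coords_first :
    Function.update (coords s a x y z) a w = coords s a w y z := by
  rw [eq_coords s a (Function.update _ _ _)]
  have h := nextDir_ne s a
  have h' : nextDir s (nextDir s a) ≠ a := fun h' => by
    have := nextDir_three s a
    rw [h'] at this
    exact h this
  simp [Function.update_of_ne h, Function.update_of_ne h']

@[simp] theorem update_coords_second :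
    Function.update (coords s a x y z) (nextDir s a) w = coords s a x w z := by
  rw [eq_coords s a (Function.update _ _ _)]
  simp [Function.update_of_ne (nextDir_ne s a).symm, Function.update_of_ne (nextDir_ne s _)]

@[simp] theorem update_coords_third :
    Function.update (coords s a x y z) (nextDir s (nextDir s a)) w = coords s a x y w := by
  have h' : nextDir s (nextDir s a) ≠ a := fun h' => by
    have := nextDir_three s a
    rw [h'] at this
    exact nextDir_ne s a this
  rw [eq_coords s a (Function.update _ _ _)]
  simp [Function.update_of_ne h'.symm, Function.update_of_ne (nextDir_ne s (nextDir s a)).symm]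

variable {s a}

theorem rawStep_down {p : Fin 3 → ℕ} (h : ∑ i, p i + 1 = k) :
    rawStep k (s, p, a) = (s, Function.update p a (p a + 1), nextDir s a) :=
  if_neg (by dsimp only; omega)

theorem rawStep_up {p : Fin 3 → ℕ} (h : ∑ i, p i = k) (ha : p a ≠ 0) :
    rawStep k (s, p, a) = (s, Function.update p a (p a - 1), nextDir s a) :=
  (if_pos h).trans (if_neg ha)

theorem rawStep_flip {p : Fin 3 → ℕ} (h : ∑ i, p i = k) (ha : p a = 0) :
    rawStep k (s, p, a) = (Function.update s a (!s a), p, nextDir s (nextDir s a)) :=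
  (if_pos h).trans (if_pos ha)

variable (s a)

/-- The walk goes around the lattice point whose coordinates in the directions `a`, `nextDir s a`,
`nextDir s (nextDir s a)` are `x`, `y + 1`, `z`. If `x` or `z` vanishes, this point lies on an edge
of the octahedron and the walk crosses that edge twice; otherwise it stays in one side. -/
theorem rawStep_six {p : Fin 3 → ℕ} (hp : ∑ i, p i = k)
    (h : p a ≠ 0 ∨ p (nextDir s (nextDir s a)) ≠ 0) :
    (rawStep k)^[6] (s, p, a) = (s, p, a) := by
  rw [eq_coords s a p] at hp ⊢
  rw [sum_coords] at hp
  generalize p a = x at *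
  generalize p (nextDir s a) = y at *
  generalize p (nextDir s (nextDir s a)) = z at *
  obtain rfl | ⟨x, rfl⟩ : x = 0 ∨ ∃ x', x = x' + 1 := by cases x <;> simp
  · obtain ⟨z, rfl⟩ : ∃ z', z = z' + 1 := ⟨z - 1, by omega⟩
    rw [Function.iterate_succ_apply, rawStep_flip (by simp; omega) (by simp),
      Function.iterate_succ_apply, rawStep_up (by simp; omega) (by simp)]
    simp only [nextDir_update, nextDir_three, update_coords_third, coords_third, Nat.add_sub_cancel]
    rw [Function.iterate_succ_apply, rawStep_down (by simp; omega)]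
    simp only [nextDir_update, nextDir_three, update_coords_second, coords_second]
    rw [Function.iterate_succ_apply, rawStep_flip (by simp; omega) (by simp)]
    simp only [nextDir_update, nextDir_three, Function.update_idem, Function.update_self,
      Bool.not_not, Function.update_eq_self]
    rw [Function.iterate_succ_apply, rawStep_up (by simp; omega) (by simp)]
    simp only [update_coords_second, coords_second, Nat.add_sub_cancel]
    rw [Function.iterate_succ_apply, rawStep_down (by simp; omega)]
    simp [nextDir_three]
  · obtain rfl | ⟨z, rfl⟩ : z = 0 ∨ ∃ x', z = x' + 1 := by cases z <;> simp
    · rw [Function.iterate_succ_apply, rawStep_up (by simp; omega) (by simp)]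
      simp only [update_coords_first, coords_first, Nat.add_sub_cancel]
      rw [Function.iterate_succ_apply, rawStep_down (by simp; omega)]
      simp only [update_coords_second, coords_second]
      rw [Function.iterate_succ_apply, rawStep_flip (by simp; omega) (by simp)]
      simp only [nextDir_three]
      rw [Function.iterate_succ_apply, rawStep_up (by simp; omega) (by simp)]
      simp only [nextDir_update, nextDir_three, update_coords_second, coords_second,
        Nat.add_sub_cancel]
      rw [Function.iterate_succ_apply, rawStep_down (by simp; omega)]
      simp only [nextDir_update, update_coords_first, coords_first]
      rw [Function.iterate_succ_apply, rawStep_flip (by simp; omega) (by simp)]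
      simp [nextDir_update, nextDir_three]
    · rw [Function.iterate_succ_apply, rawStep_up (by simp; omega) (by simp)]
      simp only [update_coords_first, coords_first, Nat.add_sub_cancel]
      rw [Function.iterate_succ_apply, rawStep_down (by simp; omega)]
      simp only [update_coords_second, coords_second]
      rw [Function.iterate_succ_apply, rawStep_up (by simp; omega) (by simp)]
      simp only [nextDir_three, update_coords_third, coords_third, Nat.add_sub_cancel]
      rw [Function.iterate_succ_apply, rawStep_down (by simp; omega)]
      simp only [update_coords_first, coords_first]
      rw [Function.iterate_succ_apply, rawStep_up (by simp; omega) (by simp)]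
      simp only [update_coords_second, coords_second, Nat.add_sub_cancel]
      rw [Function.iterate_succ_apply, rawStep_down (by simp; omega)]
      simp [nextDir_three]

theorem rawStep_four {p : Fin 3 → ℕ} (hp : ∑ i, p i = k) (h : p a = 0)
    (h' : p (nextDir s (nextDir s a)) = 0) : (rawStep k)^[4] (s, p, a) = (s, p, a) := by
  have hne : nextDir s (nextDir s a) ≠ a := fun h => by
    have := nextDir_three s a
    rw [h] at this
    exact nextDir_ne s a this
  rw [Function.iterate_succ_apply, rawStep_flip hp h,
    Function.iterate_succ_apply, rawStep_flip hp h']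
  simp only [nextDir_update, nextDir_three]
  rw [Function.iterate_succ_apply, rawStep_flip hp h]
  simp only [nextDir_update, nextDir_three]
  rw [Function.iterate_succ_apply, rawStep_flip hp h']
  simp only [nextDir_update, nextDir_three]
  generalize nextDir s (nextDir s a) = c at hne
  rw [Function.iterate_zero, id]
  congr 1
  funext i
  by_cases h1 : i = c
  · subst h1
    simp [hne]
  · by_cases h2 : i = a
    · subst h2
      simp [h1]
    · simp [h1, h2]

end Coords

/-- The face is the corner of the triangle in direction `nextDir s a`; it is a square exactly when
this point is a vertex of the octahedron. -/
theorem faceSize_dart_of_up {s : Fin 3 → Bool} {p : Fin 3 → ℕ} (hp : ∑ i, p i = k) (a : Fin 3) :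
    (goodeyC k).faceSize (dart (⟨(s, p), Or.inl hp⟩, a)) =
      if p = Pi.single (nextDir s a) k then 4 else 6 := by
  have key : p = Pi.single (nextDir s a) k ↔ p a = 0 ∧ p (nextDir s (nextDir s a)) = 0 := by
    constructor
    · rintro rfl
      simp [nextDir_ne, (nextDir_ne s a).symm]
    · rintro ⟨h1, h2⟩
      have h3 := eq_coords s a p
      rw [h3, sum_coords] at hp
      rw [h1, h2] at h3 hp
      rw [h3]
      funext i
      by_cases hi : i = a
      · subst hi
        simp [(nextDir_ne s i).symm]
      · simp only [coords, Pi.single_apply, hi, if_false]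
        congr 1
        omega
  split_ifs with h
  · exact (goodeyC k).faceSize_eq_four ncard_neighborSet parity_of_adj
      (isPeriodicPt_of_rawStep (rawStep_four s a hp (key.1 h).1 (key.1 h).2))
  · refine (goodeyC k).faceSize_eq_six ncard_neighborSet parity_of_adj
      (isPeriodicPt_of_rawStep (rawStep_six s a hp ?_))
    rw [key] at h
    tauto

theorem faceSize_dart_of_down {v : GoodeyVertex k} (hv : ∑ i, v.1.2 i ≠ k) (a : Fin 3) :
    (goodeyC k).faceSize (dart (v, a)) = 6 := by
  have e := nbr_val a v
  rw [if_neg hv] at e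
  have hs := (sum_update_succ v.1.2 a).trans (v.2.resolve_left hv)
  have e' : nbr a v = ⟨(v.1.1, Function.update v.1.2 a (v.1.2 a + 1)), Or.inl hs⟩ := Subtype.ext e
  rw [← RotationSystem.faceSize_faceStep, faceStep_dart, turn_eq, e']
  refine (faceSize_dart_of_up hs _).trans (if_neg fun h => ?_)
  have h1 := congrFun h a
  rw [Function.update_self, Pi.single_apply] at h1
  dsimp only at h1
  split_ifs at h1 with h2
  have := nextDir_three v.1.1 a
  rw [← h2] at this
  exact nextDir_ne _ _ this

theorem faceSize_eq (d : (graph k).Dart) :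
    (goodeyC k).faceSize d = 4 ∨ (goodeyC k).faceSize d = 6 := by
  obtain ⟨⟨v, a⟩, rfl⟩ := dart_bijective.2 d
  by_cases hv : ∑ i, v.1.2 i = k
  · have := faceSize_dart_of_up (s := v.1.1) hv a
    have e : v = ⟨(v.1.1, v.1.2), Or.inl hv⟩ := rfl
    rw [e, this]
    split_ifs <;> simp
  · exact Or.inr (faceSize_dart_of_down hv a)

/-- Each of the eight sides has three corners, each carrying one dart of a square. -/
theorem ncard_faceSize_eq_four : {d | (goodeyC k).faceSize d = 4}.ncard = 24 := by
  let f : (Fin 3 → Bool) × Fin 3 → (graph k).Dart := fun x =>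
    dart (⟨(x.1, Pi.single (nextDir x.1 x.2) k), Or.inl (by simp)⟩, x.2)
  have hf : Function.Injective f := by
    rintro ⟨s, a⟩ ⟨t, b⟩ h
    have := dart_bijective.1 h
    simp only [Prod.mk.injEq, Subtype.mk.injEq] at this
    exact Prod.ext this.1.1 this.2
  have e : {d | (goodeyC k).faceSize d = 4} = Set.range f := by
    ext d
    constructor
    · intro h
      obtain ⟨⟨v, a⟩, rfl⟩ := dart_bijective.2 d
      by_cases hv : ∑ i, v.1.2 i = k
      · have h' := (faceSize_dart_of_up (s := v.1.1) hv a).symm.trans h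
        split_ifs at h' with h1
        · refine ⟨(v.1.1, a), ?_⟩
          have e : v = ⟨(v.1.1, Pi.single (nextDir v.1.1 a) k), Or.inl (by simp)⟩ :=
            Subtype.ext (Prod.ext rfl h1)
          rw [e]
        · omega
      · have := (faceSize_dart_of_down hv a).symm.trans h
        omega
    · rintro ⟨⟨s, a⟩, rfl⟩
      exact (faceSize_dart_of_up (by simp) a).trans (if_pos rfl)
  rw [e, ← Set.image_univ, Set.ncard_image_of_injective _ hf, Set.ncard_univ]
  simp

theorem isGoodey (k : ℕ) : (goodeyC k).IsGoodey where
  finite := inferInstance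
  connected := connected
  cubic := ncard_neighborSet
  euler := ((goodeyC k).euler_iff ncard_neighborSet faceSize_eq).2 ncard_faceSize_eq_four
  faceSize_eq := faceSize_eq

/-! ### The coloring of `C_k` -/

/-- The distance-two four-coloring of `C_k`, with colors in the Klein four-group. -/
def color (v : GoodeyVertex k) : ZMod 2 × ZMod 2 :=
  ((if v.1.1 0 then 1 else 0) + v.1.2 0 + ((if v.1.1 2 then 1 else 0) + v.1.2 2),
    (if v.1.1 1 then 1 else 0) + v.1.2 1 + ((if v.1.1 2 then 1 else 0) + v.1.2 2))

/-- Whether direction `a` flips a sign, lowers a coordinate or raises it, modulo 2 it adds 1 to sign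
bit plus coordinate in position `a`, and changes no other position. -/
theorem color_nbr (a : Fin 3) (v : GoodeyVertex k) :
    color (nbr a v) = color v + (![(1, 0), (0, 1), (1, 1)] : Fin 3 → ZMod 2 × ZMod 2) a := by
  have key : ∀ b : Fin 3, (if (nbr a v).1.1 b then 1 else 0) + ((nbr a v).1.2 b : ZMod 2) =
      (if v.1.1 b then 1 else 0) + (v.1.2 b : ZMod 2) + if b = a then 1 else 0 := by
    intro b
    rw [nbr_val]
    have two : (1 : ZMod 2) + 1 = 0 := rfl
    by_cases hk : ∑ b, v.1.2 b = k
    · by_cases ha : v.1.2 a = 0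
      · rw [if_pos hk, if_pos ha]
        by_cases hb : b = a
        · subst hb
          simp only [Function.update_self, if_true]
          generalize (v.1.2 b : ZMod 2) = t
          generalize v.1.1 b = u
          revert t u
          decide
        · simp [hb]
      · rw [if_pos hk, if_neg ha]
        by_cases hb : b = a
        · subst hb
          have h : ((v.1.2 b - 1 : ℕ) : ZMod 2) = v.1.2 b + 1 := by
            obtain ⟨n, hn⟩ := Nat.exists_eq_succ_of_ne_zero ha
            simp [hn, add_assoc, two]
          simp [h, add_assoc]
        · simp [hb]
    · rw [if_neg hk]
      by_cases hb : b = a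
      · subst hb
        simp [add_assoc]
      · simp [hb]
  rw [color, key, key, key, color]
  fin_cases a <;> simp <;> ring_nf
  simp

theorem exists_coloring (k : ℕ) :
    ∃ c : GoodeyVertex k → Fin 4, IsDistanceTwoColoring (graph k) c := by
  let e : ZMod 2 × ZMod 2 ≃ Fin 4 := finProdFinEquiv (m := 2) (n := 2)
  refine ⟨fun v => e (color v), fun v => ?_⟩
  have h1 : ∀ a, color (nbr a v) ≠ color v := fun a => by
    rw [color_nbr, Ne, add_eq_left]
    fin_cases a <;> decide
  have h2 : ∀ a b, color (nbr a v) = color (nbr b v) → a = b := fun a b h => by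
    rw [color_nbr, color_nbr, add_right_inj] at h
    revert h
    fin_cases a <;> fin_cases b <;> decide
  rintro x (rfl | ⟨a, rfl⟩) y (rfl | ⟨b, rfl⟩) hxy
  · rfl
  · exact absurd (e.injective hxy).symm (h1 b)
  · exact absurd (e.injective hxy) (h1 a)
  · rw [h2 a b (e.injective hxy)]

end GoodeyVertex

/-! ### From a coloring to a cut system -/

namespace RotationSystem

variable {V : Type*} {G : SimpleGraph V} (R : RotationSystem G) {c : V → Fin 4}

/-- An edge is cut by a distance-two four-coloring if the two ends of the edge see the colors in
opposite cyclic orders. -/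
def IsCut (R : RotationSystem G) (c : V → Fin 4) (d : G.Dart) : Prop :=
  c (R.rot d).snd = c (R.faceStep d).snd

theorem isCut_symm (d : G.Dart) : R.IsCut c d.symm ↔ R.IsCut c d := by
  simp only [IsCut, faceStep_apply, SimpleGraph.Dart.symm_symm]
  exact eq_comm

section Coloring

variable [Finite V] (hc : ∀ v, (G.neighborSet v).ncard = 3) (hcol : IsDistanceTwoColoring G c)

omit [Finite V] in
include hcol in
theorem color_fst_ne_snd (d : G.Dart) : c d.fst ≠ c d.snd := fun h =>
  d.adj.ne (hcol d.fst (Set.mem_insert _ _) (Set.mem_insert_of_mem _ d.adj) h)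

omit [Finite V] in
include hcol in
theorem color_snd_ne {d d' : G.Dart} (h : d.fst = d'.fst) (hne : d ≠ d') :
    c d.snd ≠ c d'.snd := by
  intro hcc
  apply hne
  have h1 : d'.snd ∈ G.neighborSet d.fst := by rw [h]; exact d'.adj
  have h2 := hcol d.fst (Set.mem_insert_of_mem _ d.adj) (Set.mem_insert_of_mem _ h1) hcc
  exact SimpleGraph.Dart.ext _ _ (Prod.ext h h2)

omit [Finite V] in
theorem faceStep_fst (d : G.Dart) : (R.faceStep d).fst = d.snd := R.rot_fst _

include hc hcol

theorem color_ne_faceStep_snd (d : G.Dart) : c d.fst ≠ c (R.faceStep d).snd := by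
  have := color_snd_ne hcol (d := d.symm) (d' := R.faceStep d) (R.rot_fst _).symm
    (R.rot_ne hc d.symm).symm
  exact this

/-- The start of the middle edge sees all four colors, so the end of the three-edge path has the
color of either its beginning or the neighbor off the path; cut means the latter. Thus being cut can
be read off from the colors along one face. -/
theorem isCut_faceStep_iff (d : G.Dart) :
    R.IsCut c (R.faceStep d) ↔ c d.fst ≠ c (R.faceStep (R.faceStep d)).snd := by
  have e : R.rot (R.faceStep d) = R.rot (R.rot d.symm) := rfl
  have h1 : c d.fst ≠ c (R.faceStep d).snd := R.color_ne_faceStep_snd hc hcol d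
  have h2 := R.color_ne_faceStep_snd hc hcol (R.faceStep d)
  have h3 := color_fst_ne_snd hcol (R.faceStep d)
  have h4 := color_fst_ne_snd hcol (R.faceStep (R.faceStep d))
  have h5 := color_fst_ne_snd hcol d
  have h6 := color_fst_ne_snd hcol (R.rot (R.faceStep d))
  have h7 := color_snd_ne hcol (d := R.faceStep d) (d' := R.rot (R.faceStep d))
    (R.rot_fst _).symm (R.rot_ne hc _).symm
  have h8 := color_snd_ne hcol (d := d.symm) (d' := R.rot (R.faceStep d))
    (by rw [R.rot_fst, faceStep_fst]; rfl) (by rw [e]; exact (R.rot_rot_ne hc _).symm)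
  change c d.fst ≠ _ at h8
  rw [R.rot_fst] at h6
  rw [faceStep_fst] at h2 h3 h4 h6
  rw [IsCut]
  generalize c d.fst = x at *
  generalize c d.snd = y at *
  generalize c (R.faceStep d).snd = z at *
  generalize c (R.faceStep (R.faceStep d)).snd = u at *
  generalize c (R.rot (R.faceStep d)).snd = w at *
  omega

theorem isCut_iff_of_isPeriodicPt {n : ℕ} {d : G.Dart}
    (h : Function.IsPeriodicPt R.faceStep (n + 1) d) :
    R.IsCut c d ↔ c (R.faceStep^[n] d).fst ≠ c (R.faceStep (R.faceStep d)).fst := by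
  have h1 : R.faceStep (R.faceStep^[n] d) = d := (Function.iterate_succ_apply' _ _ _).symm.trans h
  have h2 := R.isCut_faceStep_iff hc hcol (R.faceStep^[n] d)
  rwa [h1, ← faceStep_fst] at h2

/-- In a square the vertices before and after an edge are adjacent, hence differently colored. -/
theorem isCut_of_isPeriodicPt_four {d : G.Dart} (h : Function.IsPeriodicPt R.faceStep 4 d) :
    R.IsCut c d := by
  rw [R.isCut_iff_of_isPeriodicPt hc hcol h]
  have := color_fst_ne_snd hcol (R.faceStep^[2] d)
  rw [← faceStep_fst] at this
  exact this.symm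

section Hexagon

variable {d : G.Dart} (h : Function.IsPeriodicPt R.faceStep 6 d)

include h

theorem isCut_faceStep_three :
    R.IsCut c (R.faceStep (R.faceStep (R.faceStep d))) ↔ R.IsCut c d := by
  rw [R.isCut_faceStep_iff hc hcol, R.isCut_iff_of_isPeriodicPt hc hcol h, ← faceStep_fst]
  exact ne_comm

/-- If `d` is cut, the four vertices around it on the hexagon use all four colors, which forces the
remaining two. The two equalities obtained are what makes the next two sides uncut. -/
theorem color_eq_of_isCut (hd : R.IsCut c d) :
    c d.fst = c (R.faceStep (R.faceStep (R.faceStep d))).fst ∧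
      c (R.faceStep d).fst = c (R.faceStep (R.faceStep (R.faceStep (R.faceStep d)))).fst := by
  rw [R.isCut_iff_of_isPeriodicPt hc hcol h] at hd
  have h1 : ∀ d, c d.fst ≠ c (R.faceStep d).fst := fun d => by
    rw [faceStep_fst]; exact color_fst_ne_snd hcol d
  have h2 : ∀ d, c d.fst ≠ c (R.faceStep (R.faceStep d)).fst := fun d => by
    rw [faceStep_fst]; exact R.color_ne_faceStep_snd hc hcol d
  change c (R.faceStep (R.faceStep (R.faceStep (R.faceStep (R.faceStep d))))).fst ≠ _ at hd
  have e : R.faceStep (R.faceStep (R.faceStep (R.faceStep (R.faceStep (R.faceStep d))))) = d := h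
  have a0 := h1 d
  have b0 := h2 d
  have a1 := h1 (R.faceStep d)
  have b1 := h2 (R.faceStep d)
  have a2 := h1 (R.faceStep (R.faceStep d))
  have b2 := h2 (R.faceStep (R.faceStep d))
  have a3 := h1 (R.faceStep (R.faceStep (R.faceStep d)))
  have b3 := h2 (R.faceStep (R.faceStep (R.faceStep d)))
  have a4 := h1 (R.faceStep (R.faceStep (R.faceStep (R.faceStep d))))
  have b4 := h2 (R.faceStep (R.faceStep (R.faceStep (R.faceStep d))))
  have a5 := h1 (R.faceStep (R.faceStep (R.faceStep (R.faceStep (R.faceStep d)))))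
  have b5 := h2 (R.faceStep (R.faceStep (R.faceStep (R.faceStep (R.faceStep d)))))
  rw [e] at b4 a5 b5
  generalize c d.fst = x0 at *
  generalize c (R.faceStep d).fst = x1 at *
  generalize c (R.faceStep (R.faceStep d)).fst = x2 at *
  generalize c (R.faceStep (R.faceStep (R.faceStep d))).fst = x3 at *
  generalize c (R.faceStep (R.faceStep (R.faceStep (R.faceStep d)))).fst = x4 at *
  generalize c (R.faceStep (R.faceStep (R.faceStep (R.faceStep (R.faceStep d))))).fst = x5 at *
  omega

theorem not_isCut_faceStep (hd : R.IsCut c d) : ¬ R.IsCut c (R.faceStep d) := by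
  rw [R.isCut_faceStep_iff hc hcol, not_not, ← faceStep_fst]
  exact (R.color_eq_of_isCut hc hcol h hd).1

theorem not_isCut_faceStep_faceStep (hd : R.IsCut c d) :
    ¬ R.IsCut c (R.faceStep (R.faceStep d)) := by
  rw [R.isCut_faceStep_iff hc hcol, not_not, ← faceStep_fst]
  exact (R.color_eq_of_isCut hc hcol h hd).2

end Hexagon

/-- The cut system of a distance-two four-coloring of a Goodey graph. -/
def cutSystem (hs : ∀ d, R.faceSize d = 4 ∨ R.faceSize d = 6) : CutSystem G.Dart :=
  have hper : ∀ d, R.faceSize d ≠ 4 → Function.IsPeriodicPt R.faceStep 6 d := fun d h => by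
    have h1 := Function.isPeriodicPt_minimalPeriod R.faceStep d
    rwa [show Function.minimalPeriod R.faceStep d = 6 from (hs d).resolve_left h] at h1
  { opp := SimpleGraph.Dart.symm
    rot := R.rot
    sq d := R.faceSize d = 4
    cut := R.IsCut c
    opp_opp := SimpleGraph.Dart.symm_symm
    rot_rot_rot := R.rot_rot_rot hc
    sq_rot_opp d := by
      change R.faceSize (R.faceStep d) = 4 ↔ _
      rw [faceSize_faceStep]
    four d h := by
      have h1 := Function.isPeriodicPt_minimalPeriod R.faceStep d
      rw [show Function.minimalPeriod R.faceStep d = 4 from h] at h1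
      exact h1
    six d h := hper d h
    cut_opp := R.isCut_symm
    cut_of_sq d h := by
      have h1 := Function.isPeriodicPt_minimalPeriod R.faceStep d
      rw [show Function.minimalPeriod R.faceStep d = 4 from h] at h1
      exact R.isCut_of_isPeriodicPt_four hc hcol h1
    cut_three d h := R.isCut_faceStep_three hc hcol (hper d h)
    not_cut_one d h := R.not_isCut_faceStep hc hcol (hper d h)
    not_cut_two d h := R.not_isCut_faceStep_faceStep hc hcol (hper d h) }

end Coloring

/-! ### Coverings between Goodey graphs are isomorphisms -/

section Covering

variable {V W : Type*} {G : SimpleGraph V} {H : SimpleGraph W} {R : RotationSystem G}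
  {S : RotationSystem H} {f : H.Dart → G.Dart}

theorem IsGoodey.ncard_faceSize_eq_four (hR : R.IsGoodey) :
    {d | R.faceSize d = 4}.ncard = 24 :=
  have := hR.finite
  (R.euler_iff hR.cubic hR.faceSize_eq).1 hR.euler

theorem IsGoodey.exists_dart (hR : R.IsGoodey) : ∃ d, R.faceSize d = 4 :=
  Set.nonempty_of_ncard_ne_zero (s := {d | R.faceSize d = 4})
    (by rw [hR.ncard_faceSize_eq_four]; norm_num)

theorem IsGoodey.exists_dart_fst (hR : R.IsGoodey) (v : V) : ∃ d : G.Dart, d.fst = v := by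
  obtain ⟨w, hw⟩ := Set.nonempty_of_ncard_ne_zero (s := G.neighborSet v)
    (by rw [hR.cubic]; norm_num)
  exact ⟨⟨(v, w), hw⟩, rfl⟩

variable (hR : R.IsGoodey) (hS : S.IsGoodey) (hrot : ∀ d, f (S.rot d) = R.rot (f d))
  (hsymm : ∀ d, f d.symm = (f d).symm)

include hR hS hrot hsymm

/-- Facial walks map to facial walks, so the size of the image divides the original one; between 4
and 6 this forces equality. -/
theorem IsGoodey.faceSize_covering (d : H.Dart) : R.faceSize (f d) = S.faceSize d := by
  have hstep : Function.Semiconj f S.faceStep R.faceStep := fun d => by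
    rw [faceStep_apply, faceStep_apply, hrot, hsymm]
  have h : R.faceSize (f d) ∣ S.faceSize d := by
    apply Function.IsPeriodicPt.minimalPeriod_dvd
    have h1 := (hstep.iterate_right (S.faceSize d)) d
    rw [show S.faceStep^[S.faceSize d] d = d from
      Function.isPeriodicPt_minimalPeriod S.faceStep d] at h1
    exact h1.symm
  rcases hR.faceSize_eq (f d) with h1 | h1 <;> rcases hS.faceSize_eq d with h2 | h2 <;>
    rw [h1, h2] at h ⊢ <;> revert h <;> decide

theorem IsGoodey.covering_surjective : Function.Surjective f := by
  obtain ⟨d, -⟩ := hS.exists_dart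
  have := hR.finite
  refine R.dart_induction hR.connected (f d) ⟨d, rfl⟩ ?_ ?_ ?_
  · rintro _ ⟨d, rfl⟩
    exact ⟨S.rot d, hrot d⟩
  · rintro e ⟨d, hd⟩
    refine ⟨S.rot (S.rot d), ?_⟩
    rw [hrot, hrot, hd, R.rot_rot_rot hR.cubic]
  · rintro _ ⟨d, rfl⟩
    exact ⟨d.symm, hsymm d⟩

/-- Both graphs have 24 darts on squares, and `f` maps one set onto the other, hence injectively.
Having at most one preimage is inherited under rotation and reversal, so it spreads from a square
dart to all darts. -/
theorem IsGoodey.covering_injective : Function.Injective f := by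
  have := hR.finite
  have := hS.finite
  have hsq : Set.InjOn f {d | S.faceSize d = 4} := by
    have himg : f '' {d | S.faceSize d = 4} = {d | R.faceSize d = 4} := by
      ext e
      constructor
      · rintro ⟨d, hd, rfl⟩
        exact (hR.faceSize_covering hS hrot hsymm d).trans hd
      · intro he
        obtain ⟨d, rfl⟩ := hR.covering_surjective hS hrot hsymm e
        exact ⟨d, (hR.faceSize_covering hS hrot hsymm d).symm.trans he, rfl⟩
    refine Set.injOn_of_ncard_image_eq ?_ (Set.toFinite _)
    rw [himg, hR.ncard_faceSize_eq_four, hS.ncard_faceSize_eq_four]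
  have key : ∀ e : G.Dart, ∀ d d' : H.Dart, f d = e → f d' = e → d = d' := by
    obtain ⟨d₀, h₀⟩ := hR.exists_dart
    refine R.dart_induction hR.connected d₀ ?_ ?_ ?_ ?_
    · intro d d' h h'
      refine hsq ?_ ?_ (h.trans h'.symm)
      · change S.faceSize d = 4
        rw [← hR.faceSize_covering hS hrot hsymm, h, h₀]
      · change S.faceSize d' = 4
        rw [← hR.faceSize_covering hS hrot hsymm, h', h₀]
    · intro e ih d d' h h'
      apply S.rot.injective
      apply S.rot.injective
      apply ih <;> simp [hrot, h, h', R.rot_rot_rot hR.cubic]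
    · intro e ih d d' h h'
      apply S.rot.injective
      apply ih <;> simp [hrot, h, h']
    · intro e ih d d' h h'
      apply SimpleGraph.Dart.symm_involutive.injective
      apply ih <;> simp [hsymm, h, h']
  exact fun d d' h => key _ d d' h rfl

/-- A covering of one Goodey graph by another is an isomorphism. -/
theorem IsGoodey.isIsoTo_of_covering : R.IsIsoTo S := by
  have := hR.finite
  have := hS.finite
  have hinj := hR.covering_injective hS hrot hsymm
  have hsurj := hR.covering_surjective hS hrot hsymm
  -- Vertices are the orbits of the rotation, so `f` descends to a bijection `F` of vertices.
  have hfst : ∀ d d', (f d).fst = (f d').fst ↔ d.fst = d'.fst := by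
    intro d d'
    have hpow : ∀ (n : ℕ) d, f ((S.rot ^ n) d) = (R.rot ^ n) (f d) := fun n d => by
      rw [Equiv.Perm.coe_pow, Equiv.Perm.coe_pow]
      exact (Function.Semiconj.iterate_right hrot n) d
    constructor
    · intro h
      obtain ⟨n, hn⟩ := (R.sameCycle_of_fst_eq _ _ h).exists_nat_pow_eq
      rw [← hpow] at hn
      rw [← hinj hn]
      exact (S.rot_zpow_fst d n).symm
    · intro h
      obtain ⟨n, hn⟩ := (S.sameCycle_of_fst_eq _ _ h).exists_nat_pow_eq
      rw [← hn, hpow]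
      exact (R.rot_zpow_fst (f d) n).symm
  choose g hg using hS.exists_dart_fst
  let F : W → V := fun w => (f (g w)).fst
  have hF : ∀ d : H.Dart, F d.fst = (f d).fst := fun d => (hfst _ _).2 (hg _)
  have hF' : ∀ d : H.Dart, F d.snd = (f d).snd := fun d => by
    have := hF d.symm
    rw [hsymm] at this
    exact this
  have hFb : Function.Bijective F := by
    constructor
    · intro w w' h
      rw [← hg w, ← hg w']
      exact (hfst _ _).1 h
    · intro v
      obtain ⟨d, rfl⟩ := hR.exists_dart_fst v
      obtain ⟨d, rfl⟩ := hsurj d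
      exact ⟨d.fst, hF d⟩
  have hadj : ∀ w w', G.Adj (F w) (F w') ↔ H.Adj w w' := by
    intro w w'
    constructor
    · intro h
      obtain ⟨d, hd⟩ := hsurj ⟨(F w, F w'), h⟩
      have h1 : d.fst = w := hFb.1 (by rw [hF, hd])
      have h2 : d.snd = w' := hFb.1 (by rw [hF', hd])
      exact h1 ▸ h2 ▸ d.adj
    · intro h
      have h1 := hF ⟨(w, w'), h⟩
      have h2 := hF' ⟨(w, w'), h⟩
      dsimp only at h1 h2
      rw [h1, h2]
      exact (f _).adj
  let e : H ≃g G := ⟨Equiv.ofBijective F hFb, fun {w w'} => hadj w w'⟩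
  have he : ∀ d : H.Dart, e.symm.toHom.mapDart (f d) = d := by
    intro d
    apply SimpleGraph.Dart.ext
    apply Prod.ext
    · change e.symm (f d).fst = d.fst
      rw [← hF]
      exact e.symm_apply_apply _
    · change e.symm (f d).snd = d.snd
      rw [← hF']
      exact e.symm_apply_apply _
  refine ⟨e.symm, fun d => ?_⟩
  obtain ⟨d, rfl⟩ := hsurj d
  rw [← hrot, he, he]

end Covering

/-! ### Conclusion -/

theorem IsGoodey.exists_isIsoTo_goodeyC {V : Type*} {G : SimpleGraph V} {R : RotationSystem G}
    (hR : R.IsGoodey) {c : V → Fin 4} (hcol : IsDistanceTwoColoring G c) :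
    ∃ k, R.IsIsoTo (goodeyC k) := by
  have := hR.finite
  let S := R.cutSystem hR.cubic hcol hR.faceSize_eq
  obtain ⟨d, hd⟩ := hR.exists_dart
  obtain ⟨n, hn⟩ := S.exists_isLength (b := d) hd
  -- A chain reaching the next square after `k + 1` steps passes through `k` hexagons.
  obtain ⟨k, rfl⟩ : ∃ k, n = k + 1 := ⟨n - 1, by have := hn.pos; omega⟩
  let b : S.Corner k := ⟨d, hd, hn⟩
  let E := Equiv.ofBijective _ (GoodeyVertex.dart_bijective (k := k))
  have hE : ∀ x, E.symm (GoodeyVertex.dart x) = x := E.symm_apply_apply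
  refine ⟨k, hR.isIsoTo_of_covering (GoodeyVertex.isGoodey k) (f := fun d => b.dartMap (E.symm d))
    ?_ ?_⟩
  · intro d
    obtain ⟨x, rfl⟩ := GoodeyVertex.dart_bijective.2 d
    rw [GoodeyVertex.rot_dart, hE, hE]
    exact b.dartMap_turn x
  · intro d
    obtain ⟨⟨v, a⟩, rfl⟩ := GoodeyVertex.dart_bijective.2 d
    rw [GoodeyVertex.dart_symm, hE, hE]
    exact b.dartMap_nbr v a

theorem IsIsoTo.exists_coloring {V : Type*} {G : SimpleGraph V} {R : RotationSystem G} {k : ℕ}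
    (h : R.IsIsoTo (goodeyC k)) : ∃ c : V → Fin 4, IsDistanceTwoColoring G c := by
  obtain ⟨e, -⟩ := h
  obtain ⟨c, hc⟩ := GoodeyVertex.exists_coloring k
  have hmem : ∀ v x, x ∈ insert v (G.neighborSet v) →
      e x ∈ insert (e v) ((GoodeyVertex.graph k).neighborSet (e v)) := by
    rintro v x (rfl | hx)
    · exact Set.mem_insert _ _
    · exact Set.mem_insert_of_mem _ (e.map_rel_iff.2 hx)
  exact ⟨c ∘ e, fun v x hx y hy hxy => e.injective (hc (e v) (hmem v x hx) (hmem v y hy) hxy)⟩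

end RotationSystem

theorem theorem4p2 :
    (∀ k : ℕ, (goodeyC k).IsGoodey) ∧
    ∀ {V : Type*} (G : SimpleGraph V) (R : RotationSystem G), R.IsGoodey →
      ((∃ c : V → Fin 4, IsDistanceTwoColoring G c) ↔ ∃ k : ℕ, R.IsIsoTo (goodeyC k)) :=
  ⟨GoodeyVertex.isGoodey, fun _ _ hR =>
    ⟨fun ⟨_, hc⟩ => hR.exists_isIsoTo_goodeyC hc, fun ⟨_, h⟩ => h.exists_coloring⟩⟩
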